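/- **Setting.** Let $M$ be a smooth (Hausdorff) manifold of dimension $n\ge 2$. Points of $T^*M$ are written $q=(m,\mathbf p)$; a local chart of $M$ gives coordinates $(x,p)=(x^1,\dots,x^n,p_1,\dots,p_n)$ on $T^*M$. Repeated indices are summed. Let $X$ be a smooth vector field on $T^*M$; in a chart its trajectories satisfy $$\dot x^i=V^i(x,p),\qquad \dot p_i=\Theta_i(x,p).$$ The velocity $\mathbf V=\pi_*X$ is an extended vector field, i.e. $\mathbf V(q)\in T_mM$. Write $\tilde\nabla^s=\partial/\partial p_s$ and $$W^s=\tilde\nabla^sV^r\,p_r,\qquad \Omega=p_sW^s,\qquad P^i_j=\delta^i_j-\frac{W^ip_j}{\Omega}.$$ Assume that $X$ comes with a *regular* generalized Legendre map $\lambda:TM\to T^*M$: (1) $\lambda$ is a fibre-preserving diffeomorphism with inverse $(m,\mathbf p)\mapsto(m,\mathbf V(m,\mathbf p))$; (2) $\mathbf V(m,\mathbf p)=0$ if and only if $\mathbf p=0$; (3) $\Omega\ne0$ whenever $\mathbf p\ne0$. Let $\Gamma$ be any smooth symmetric extended affine connection: components $\Gamma^k_{ij}(x,p)=\Gamma^k_{ji}(x,p)$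 in each chart, transforming under changes of chart of $M$ like those of an affine connection. Put $$Q_i=\Theta_i-\Gamma^k_{ij}\,p_k\,V^j ,$$ $$\nabla_mX^{i_1\dots i_r}_{j_1\dots j_s}=\frac{\partial X^{i_1\dots i_r}_{j_1\dots j_s}}{\partial x^m}+p_c\Gamma^c_{mb}\frac{\partial X^{i_1\dots i_r}_{j_1\dots j_s}}{\partial p_b}+\sum_{k}\Gamma^{i_k}_{ma}X^{i_1\dots a\dots i_r}_{j_1\dots j_s}-\sum_k\Gamma^b_{mj_k}X^{i_1\dots i_r}_{j_1\dots b\dots j_s},$$ $$R^k_{rij}=\frac{\partial\Gamma^k_{jr}}{\partial x^i}-\frac{\partial\Gamma^k_{ir}}{\partial x^j}+\Gamma^k_{im}\Gamma^m_{jr}-\Gamma^k_{jm}\Gamma^m_{ir}+p_a\Gamma^a_{mi}\frac{\partial\Gamma^k_{jr}}{\partial p_m}-p_a\Gamma^a_{mj}\frac{\partial\Gamma^k_{ir}}{\partial p_m},\qquad D^{kr}_{ij}=-\frac{\partial\Gamma^k_{ij}}{\partial p_r},$$ $$\begin{aligned}\alpha^k={}&\tilde\nabla^kV^iQ_i+\nabla_r\tilde\nabla^kV^i\,p_iV^r+\tilde\nabla^r\tilde\nabla^kV^i\,p_iQ_r+\tilde\nabla^rV^i\,p_i\tilde\nabla^kQ_r\\&-D^{sk}_{rj}\tilde\nabla^rV^i\,p_ip_sV^j+\nabla_rV^i\,p_i\tilde\nabla^kV^r+\tilde\nabla^kV^rQ_r,\end{aligned}$$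 $$\begin{aligned}\beta_k={}&\nabla_r\nabla_kV^i\,p_iV^r+V^r\nabla_rQ_k+\nabla_kV^iQ_i+\tilde\nabla^r\nabla_kV^i\,p_iQ_r+\tilde\nabla^rQ_k\,Q_r+\nabla_kV^rQ_r\\&+\nabla_rV^i\,p_i\nabla_kV^r+\tilde\nabla^rV^i\,p_i\nabla_kQ_r-\bigl(R^s_{rjk}V^j-D^{sj}_{rk}Q_j\bigr)\tilde\nabla^rV^i\,p_ip_s,\end{aligned}$$ $$\eta_k=\beta_k-\frac{\nabla_kV^i\,p_i\,\alpha^sp_s}{\Omega}-\frac{Q_k\,\alpha^sp_s}{\Omega}.$$ **Weak normality condition.** A smooth one-parametric family of trajectories $q(t,y)$ of $X$, with base points $m(t,y)$ and momenta $\mathbf p(t,y)$, that for $y=0$ gives a trajectory $q(t)$ defines on it the variation vector $\tau=\partial m/\partial y|_{y=0}$ and the deviation function $\varphi(t)=\langle\mathbf p\,|\,\tau\rangle$. The system satisfies the weak normality condition if for each trajectory $q(t)$, defined on an open interval $J$, there is a linear homogeneous equation $$\ddot\varphi=\mathcal A(t)\,\dot\varphi+\mathcal B(t)\,\varphi\qquad(t\in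 J)$$ with smooth coefficients on $J$ that is satisfied by the deviation functions of all such families that include $q(t)$ (the family being defined for $(t,y)$ in some open set containing $J\times\{0\}$). **Theorem 8.1.** Under these assumptions the weak normality condition holds if and only if the weak normality equations $$\alpha^rP^k_r=0,\qquad \eta_rP^r_k=0\qquad(k=1,\dots,n)$$ hold, in every chart, at all points $q=(m,\mathbf p)$ of $T^*M$ with $\mathbf p\ne0$. -/

import Mathlib

open scoped Manifold ContDiff Bundle

noncomputable section

namespace NormalShift

/-- The model space `ℝⁿ`. -/
abbrev Coord (n : ℕ) : Type := Fin n → ℝ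

/-- The model with corners of an `n`-dimensional manifold without boundary. -/
abbrev baseModel (n : ℕ) : ModelWithCorners ℝ (Coord n) (Coord n) := 𝓘(ℝ, Coord n)

/-- The cotangent bundle `T*M` of an `n`-dimensional manifold: continuous linear functionals on the
tangent spaces, with Mathlib's topology and smooth structure on this bundle. Its points are
`q = (m, 𝐩)`, with `q.proj = m` and `q.2 = 𝐩`. -/
abbrev CotangentBundle (n : ℕ) (M : Type*) [TopologicalSpace M] [ChartedSpace (Coord n) M]
    [IsManifold (baseModel n) ∞ M] : Type _ :=
  Bundle.TotalSpace (Coord n →L[ℝ] ℝ) (fun x : M => TangentSpace (baseModel n) x →L[ℝ] ℝ)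

/-- The model with corners of `T*M`. -/
abbrev cotangentModel (n : ℕ) :
    ModelWithCorners ℝ (Coord n × (Coord n →L[ℝ] ℝ)) (ModelProd (Coord n) (Coord n →L[ℝ] ℝ)) :=
  (baseModel n).prod 𝓘(ℝ, Coord n →L[ℝ] ℝ)

/-- A vector field on `T*M`, that is, a dynamical system `dq/dt = X(q)` in the cotangent bundle. -/
abbrev CotangentField (n : ℕ) (M : Type*) [TopologicalSpace M] [ChartedSpace (Coord n) M]
    [IsManifold (baseModel n) ∞ M] : Type _ :=
  (q : CotangentBundle n M) → TangentSpace (cotangentModel n) q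

section Manifold

variable {n : ℕ} {M : Type*} [TopologicalSpace M] [ChartedSpace (Coord n) M]
  [IsManifold (baseModel n) ∞ M]

/-- Smoothness of a vector field on `T*M`. -/
def IsSmoothField (X : CotangentField n M) : Prop :=
  ContMDiff (cotangentModel n) (cotangentModel n).tangent ∞
    (fun q => (⟨q, X q⟩ : TangentBundle (cotangentModel n) (CotangentBundle n M)))

/-- The velocity `V(q) = π_*(X(q))` of the base point, an extended vector field. -/
def velocity (X : CotangentField n M) (q : CotangentBundle n M) :
    TangentSpace (baseModel n) q.proj :=
  mfderiv (cotangentModel n) (baseModel n)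
    (Bundle.TotalSpace.proj : CotangentBundle n M → M) q (X q)

/-- The map `T*M → TM`, `(m, 𝐩) ↦ (m, V(m, 𝐩))`. -/
def velocityMap (X : CotangentField n M) (q : CotangentBundle n M) :
    TangentBundle (baseModel n) M :=
  ⟨q.proj, velocity X q⟩

/-! ### Coordinates on `T*M` induced by a chart of `M` -/

/-- The differential at `m` of the coordinate map of a chart `φ` of `M`. -/
def chartDeriv (φ : OpenPartialHomeomorph M (Coord n)) (m : M) :
    TangentSpace (baseModel n) m →L[ℝ] Coord n :=
  @mfderiv ℝ _ (Coord n) _ _ (Coord n) _ (baseModel n) M _ _ (Coord n) _ _ (Coord n) _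
    (baseModel n) (Coord n) _ (chartedSpaceSelf (Coord n)) φ m

/-- The coordinates `(x¹, …, xⁿ, p₁, …, pₙ)` of a point of `T*M` in the chart `φ` of `M`: the
`xⁱ` are the coordinates of the base point and `pᵢ = ⟨𝐩 | ∂/∂xⁱ⟩`. -/
def coords (φ : OpenPartialHomeomorph M (Coord n)) (q : CotangentBundle n M) :
    Coord n × Coord n :=
  (φ q.proj, fun i : Fin n => q.2 ((chartDeriv φ q.proj).inverse (Pi.single i 1)))

/-- The point of `T*M` with coordinates `(x, p)` in the chart `φ`, that is, the covector
`∑ pᵢ dxⁱ` at the point with coordinates `x`. -/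
def ofCoords (φ : OpenPartialHomeomorph M (Coord n)) (z : Coord n × Coord n) :
    CotangentBundle n M :=
  ⟨φ.symm z.1, ∑ i : Fin n, z.2 i •
    (ContinuousLinearMap.proj i : Coord n →L[ℝ] ℝ).comp (chartDeriv φ (φ.symm z.1))⟩

/-- The components `(V¹, …, Vⁿ, Θ₁, …, Θₙ)` of `X` in the chart `φ`, as a function of `(x, p)`. -/
def localField (φ : OpenPartialHomeomorph M (Coord n)) (X : CotangentField n M)
    (z : Coord n × Coord n) : Coord n × Coord n :=
  mfderiv (cotangentModel n) 𝓘(ℝ, Coord n × Coord n) (coords φ) (ofCoords φ z)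
    (X (ofCoords φ z))

/-- `Vⁱ(x, p)` in the chart `φ`; along trajectories `dxⁱ/dt = Vⁱ`. -/
def locV (φ : OpenPartialHomeomorph M (Coord n)) (X : CotangentField n M) (i : Fin n)
    (z : Coord n × Coord n) : ℝ := (localField φ X z).1 i

/-- `Θᵢ(x, p)` in the chart `φ`; along trajectories `dpᵢ/dt = Θᵢ`. -/
def locTheta (φ : OpenPartialHomeomorph M (Coord n)) (X : CotangentField n M) (i : Fin n)
    (z : Coord n × Coord n) : ℝ := (localField φ X z).2 i

end Manifold

/-! ### Local calculus of extended tensor fields -/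

section Local

variable {n : ℕ}

/-- `∂f/∂xᵐ`. -/
def dx (m : Fin n) (f : Coord n × Coord n → ℝ) (z : Coord n × Coord n) : ℝ :=
  fderiv ℝ f z (Pi.single m 1, 0)

/-- `∂f/∂pₘ`. -/
def dp (m : Fin n) (f : Coord n × Coord n → ℝ) (z : Coord n × Coord n) : ℝ :=
  fderiv ℝ f z (0, Pi.single m 1)

/-- Local components `X^{I}_{J}(x, p)` of an extended tensor field of type `(r, s)`. -/
abbrev LocTensor (n r s : ℕ) : Type :=
  (Fin r → Fin n) → (Fin s → Fin n) → Coord n × Coord n → ℝ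

/-- Local components `Γ k i j = Γ^k_{ij}(x, p)` of an extended affine connection. -/
abbrev LocConn (n : ℕ) : Type := Fin n → Fin n → Fin n → Coord n × Coord n → ℝ

/-- The momentum gradient `∇̃^m X^I_J = ∂X^I_J/∂pₘ`; the index `m` becomes the first upper index. -/
def vert {r s : ℕ} (T : LocTensor n r s) : LocTensor n (r + 1) s :=
  fun I J => dp (I 0) (T (Fin.tail I) J)

/-- The horizontal covariant derivative
`∇_m X^I_J = ∂X^I_J/∂x^m + ∑ p_c Γ^c_{mb} ∂X^I_J/∂p_b
  + ∑_k ∑_a Γ^{i_k}_{ma} X^{… a …}_J - ∑_k ∑_b Γ^b_{m j_k} X^I_{… b …}`;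
the index `m` becomes the first lower index. -/
def hor (Γ : LocConn n) {r s : ℕ} (T : LocTensor n r s) : LocTensor n r (s + 1) :=
  fun I mJ z =>
    let m : Fin n := mJ 0
    let J : Fin s → Fin n := Fin.tail mJ
    dx m (T I J) z
      + ∑ b, ∑ c, z.2 c * Γ c m b z * dp b (T I J) z
      + ∑ k : Fin r, ∑ a, Γ (I k) m a z * T (Function.update I k a) J z
      - ∑ k : Fin s, ∑ b, Γ b m (J k) z * T I (Function.update J k b) z

/-- The curvature tensor `R^k_{rij}`. -/
def curvR (Γ : LocConn n) (k r i j : Fin n) (z : Coord n × Coord n) : ℝ :=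
  dx i (Γ k j r) z - dx j (Γ k i r) z
    + ∑ m, Γ k i m z * Γ m j r z - ∑ m, Γ k j m z * Γ m i r z
    + ∑ m, ∑ a, z.2 a * Γ a m i z * dp m (Γ k j r) z
    - ∑ m, ∑ a, z.2 a * Γ a m j z * dp m (Γ k i r) z

/-- The dynamic curvature tensor `D^{kr}_{ij} = -∂Γ^k_{ij}/∂p_r`. -/
def curvD (Γ : LocConn n) (k r i j : Fin n) (z : Coord n × Coord n) : ℝ :=
  - dp r (Γ k i j) z

/-- A vector field as a tensor field of type `(1, 0)`. -/
def vec (V : Fin n → Coord n × Coord n → ℝ) : LocTensor n 1 0 := fun I _ => V (I 0)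

/-- A covector field as a tensor field of type `(0, 1)`. -/
def covec (Q : Fin n → Coord n × Coord n → ℝ) : LocTensor n 0 1 := fun _ J => Q (J 0)

/-- The force covector `Q_i = Θ_i - ∑ Γ^k_{ij} p_k V^j`. -/
def force (Γ : LocConn n) (V Θ : Fin n → Coord n × Coord n → ℝ) (i : Fin n)
    (z : Coord n × Coord n) : ℝ :=
  Θ i z - ∑ j, ∑ k, Γ k i j z * z.2 k * V j z

/-- `W^s = ∑ ∇̃^s V^r p_r`. -/
def fieldW (V : Fin n → Coord n × Coord n → ℝ) (s : Fin n) (z : Coord n × Coord n) : ℝ :=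
  ∑ r, vert (vec V) ![s, r] ![] z * z.2 r

/-- `Ω = ⟨𝐩 | W⟩`. -/
def Omega (V : Fin n → Coord n × Coord n → ℝ) (z : Coord n × Coord n) : ℝ :=
  ∑ s, z.2 s * fieldW V s z

/-- The projector `P^i_j = δ^i_j - W^i p_j / Ω`. -/
def projP (V : Fin n → Coord n × Coord n → ℝ) (i j : Fin n) (z : Coord n × Coord n) : ℝ :=
  (if i = j then 1 else 0) - fieldW V i z * z.2 j / Omega V z

/-- The extended vector field `α^k`, as a function of `Γ`, `V` and `Q`. -/
def alpha (Γ : LocConn n) (V Q : Fin n → Coord n × Coord n → ℝ) (k : Fin n)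
    (z : Coord n × Coord n) : ℝ :=
  ∑ i, vert (vec V) ![k, i] ![] z * Q i z
  + ∑ r, ∑ i, hor Γ (vert (vec V)) ![k, i] ![r] z * z.2 i * V r z
  + ∑ r, ∑ i, vert (vert (vec V)) ![r, k, i] ![] z * z.2 i * Q r z
  + ∑ r, ∑ i, vert (vec V) ![r, i] ![] z * z.2 i * vert (covec Q) ![k] ![r] z
  - ∑ r, ∑ s, ∑ i, ∑ j, curvD Γ s k r j z * vert (vec V) ![r, i] ![] z * z.2 i * z.2 s * V j z
  + ∑ r, ∑ i, hor Γ (vec V) ![i] ![r] z * z.2 i * vert (vec V) ![k, r] ![] z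
  + ∑ r, vert (vec V) ![k, r] ![] z * Q r z

/-- The extended covector field `β_k`, as a function of `Γ`, `V` and `Q`. -/
def beta (Γ : LocConn n) (V Q : Fin n → Coord n × Coord n → ℝ) (k : Fin n)
    (z : Coord n × Coord n) : ℝ :=
  ∑ r, ∑ i, hor Γ (hor Γ (vec V)) ![i] ![r, k] z * z.2 i * V r z
  + ∑ r, V r z * hor Γ (covec Q) ![] ![r, k] z
  + ∑ i, hor Γ (vec V) ![i] ![k] z * Q i z
  + ∑ r, ∑ i, vert (hor Γ (vec V)) ![r, i] ![k] z * z.2 i * Q r z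
  + ∑ r, vert (covec Q) ![r] ![k] z * Q r z
  + ∑ r, hor Γ (vec V) ![r] ![k] z * Q r z
  + ∑ r, ∑ i, hor Γ (vec V) ![i] ![r] z * z.2 i * hor Γ (vec V) ![r] ![k] z
  + ∑ r, ∑ i, vert (vec V) ![r, i] ![] z * z.2 i * hor Γ (covec Q) ![] ![k, r] z
  - ∑ r, ∑ s, ∑ i, ∑ j,
      (curvR Γ s r j k z * vert (vec V) ![r, i] ![] z * z.2 i * z.2 s * V j z
        - curvD Γ s j r k z * vert (vec V) ![r, i] ![] z * z.2 i * z.2 s * Q j z)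

/-- The extended covector field
`η_k = β_k - ∑ ∇_k V^i p_i α^s p_s / Ω - ∑ Q_k α^s p_s / Ω`. -/
def eta (Γ : LocConn n) (V Q : Fin n → Coord n × Coord n → ℝ) (k : Fin n)
    (z : Coord n × Coord n) : ℝ :=
  beta Γ V Q k z
    - ∑ i, ∑ s, hor Γ (vec V) ![i] ![k] z * z.2 i * alpha Γ V Q s z * z.2 s / Omega V z
    - ∑ s, Q k z * alpha Γ V Q s z * z.2 s / Omega V z

end Local

/-! ### Extended connections, regularity, weak normality -/

/-- A smooth symmetric extended affine connection on `M` (in momentum representation): a family of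
components `Γ^k_{ij}(x, p)`, one for each smooth chart of `M`, which are smooth, symmetric in `i, j`
and related by the transformation rule
`Γ^k_{ij} = ∑ S^k_m T^a_i T^c_j Γ'^m_{ac} + ∑ S^k_m ∂T^m_i/∂x^j`, where
`S^k_m = ∂x^k/∂x'^m` and `T^a_i = ∂x'^a/∂x^i`. -/
structure SymmExtConnection (n : ℕ) (M : Type*) [TopologicalSpace M] [ChartedSpace (Coord n) M]
    [IsManifold (baseModel n) ∞ M] where
  comp : OpenPartialHomeomorph M (Coord n) → LocConn n
  smooth : ∀ φ ∈ IsManifold.maximalAtlas (baseModel n) ∞ M, ∀ k i j : Fin n,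
    ContDiffOn ℝ ∞ (comp φ k i j) (φ.target ×ˢ Set.univ)
  symm : ∀ φ ∈ IsManifold.maximalAtlas (baseModel n) ∞ M, ∀ k i j : Fin n, ∀ z : Coord n × Coord n,
    z.1 ∈ φ.target → comp φ k i j z = comp φ k j i z
  transform : ∀ φ ∈ IsManifold.maximalAtlas (baseModel n) ∞ M, ∀ ψ ∈ IsManifold.maximalAtlas (baseModel n) ∞ M,
    ∀ q : CotangentBundle n M, q.proj ∈ φ.source → q.proj ∈ ψ.source → ∀ k i j : Fin n,
    let S : Fin n → Fin n → ℝ := fun k m =>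
      fderiv ℝ (φ ∘ ψ.symm) (ψ q.proj) (Pi.single m 1) k
    let T : Fin n → Fin n → Coord n → ℝ := fun a i x =>
      fderiv ℝ (ψ ∘ φ.symm) x (Pi.single i 1) a
    comp φ k i j (coords φ q) =
      ∑ m, ∑ a, ∑ c, S k m * T a i (φ q.proj) * T c j (φ q.proj) * comp ψ m a c (coords ψ q)
      + ∑ m, S k m * fderiv ℝ (T m i) (φ q.proj) (Pi.single j 1)

section Normality

variable {n : ℕ} {M : Type*} [TopologicalSpace M] [ChartedSpace (Coord n) M]
  [IsManifold (baseModel n) ∞ M]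

/-- `lam : TM → T*M` is a regular generalized Legendre map for the dynamical system `X` in `T*M`:
it is a fibre-preserving diffeomorphism, its inverse is `(m, 𝐩) ↦ (m, V(m, 𝐩))`, where `V` is the
velocity field of `X`; `V` vanishes exactly on the zero section; and `Ω ≠ 0` off the zero
section. -/
structure IsRegularLegendre (lam : TangentBundle (baseModel n) M → CotangentBundle n M)
    (X : CotangentField n M) : Prop where
  fibre : ∀ v, (lam v).proj = v.proj
  left_inv : ∀ v, velocityMap X (lam v) = v
  right_inv : ∀ q, lam (velocityMap X q) = q
  smooth : ContMDiff (baseModel n).tangent (cotangentModel n) ∞ lam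
  smooth_inv : ContMDiff (cotangentModel n) (baseModel n).tangent ∞ (velocityMap X)
  velocity_eq_zero : ∀ q, velocity X q = 0 ↔ q.2 = 0
  Omega_ne_zero : ∀ φ ∈ IsManifold.maximalAtlas (baseModel n) ∞ M, ∀ z : Coord n × Coord n,
    z.1 ∈ φ.target → z.2 ≠ 0 → Omega (locV φ X) z ≠ 0

/-- `F(t, y)` is a smooth one-parametric family of trajectories of `X`, with parameter `y`, defined
on an open set `U` of pairs `(t, y)` containing `J × {0}`, which for `y = 0` gives the
trajectory `γ` on `J`. -/
structure IsTrajectoryFamily (X : CotangentField n M) (γ : ℝ → CotangentBundle n M) (J : Set ℝ)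
    (F : ℝ × ℝ → CotangentBundle n M) (U : Set (ℝ × ℝ)) : Prop where
  isOpen : IsOpen U
  mem : ∀ t ∈ J, (t, (0 : ℝ)) ∈ U
  smooth : ContMDiffOn 𝓘(ℝ, ℝ × ℝ) (cotangentModel n) ∞ F U
  trajectory : ∀ y : ℝ, IsMIntegralCurveOn (fun t => F (t, y)) X {t | (t, y) ∈ U}
  eq_zero : ∀ t ∈ J, F (t, 0) = γ t

/-- The deviation function `φ(t) = ⟨𝐩 | τ⟩` on the trajectory `y = 0` of a family `F(t, y)`: `τ` is
the derivative of the base point of `F(t, y)` with respect to `y` at `y = 0`. -/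
def deviation (F : ℝ × ℝ → CotangentBundle n M) (t : ℝ) : ℝ :=
  (F (t, 0)).2 (mfderiv 𝓘(ℝ, ℝ) (baseModel n) (fun y : ℝ => (F (t, y)).proj) 0 (1 : ℝ))

/-- The weak normality condition: for each trajectory `γ` (on an open interval `J`) there is a
linear homogeneous equation `φ'' = A(t) φ' + B(t) φ` with smooth coefficients that is satisfied by
the deviation functions of all one-parametric families of trajectories that include `γ`. -/
def WeakNormality (X : CotangentField n M) : Prop :=
  ∀ (J : Set ℝ) (γ : ℝ → CotangentBundle n M), IsOpen J → J.OrdConnected →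
    IsMIntegralCurveOn γ X J →
    ∃ A B : ℝ → ℝ, ContDiffOn ℝ ∞ A J ∧ ContDiffOn ℝ ∞ B J ∧
      ∀ (F : ℝ × ℝ → CotangentBundle n M) (U : Set (ℝ × ℝ)), IsTrajectoryFamily X γ J F U →
        ∀ t ∈ J, deriv (deriv (deviation F)) t
          = A t * deriv (deviation F) t + B t * deviation F t

/-- The weak normality equations `∑ α^r P^k_r = 0`, `∑ η_r P^r_k = 0` in every smooth chart of `M`,
at all points of `T*M` with `𝐩 ≠ 0`. -/
def WeakNormalityEquations (Γ : SymmExtConnection n M) (X : CotangentField n M) : Prop :=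
  ∀ φ ∈ IsManifold.maximalAtlas (baseModel n) ∞ M, ∀ z : Coord n × Coord n,
    z.1 ∈ φ.target → z.2 ≠ 0 →
    let V : Fin n → Coord n × Coord n → ℝ := locV φ X
    let Q : Fin n → Coord n × Coord n → ℝ := force (Γ.comp φ) V (locTheta φ X)
    ∀ k : Fin n,
      ∑ r, alpha (Γ.comp φ) V Q r z * projP V k r z = 0 ∧
      ∑ r, eta (Γ.comp φ) V Q r z * projP V r k z = 0

end Normality

end NormalShift

end

/-! Work in a chart, with `G = (V, Θ)` the local field. The variation `v = (τ, π)` of a family of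
trajectories solves the linearized equation `v' = DG(z) v`. Hence at each instant `φ`, `φ'` and
`φ''` are three linear forms in `v` that depend only on the point `z = (x, p)`: `pairing`, `devRate`
and `devAccel`. A smooth local flow (`exists_smooth_localFlow`) realizes every vector `v` at every
point as a variation. Weak normality therefore forces, at each point, `devAccel = A · devRate + B ·
pairing` as linear forms in `v`.

The weak normality equations are this relation in components. The connection splits `v` into `τ` and
the vertical part `ξ_r = π_r - p_c Γ^c_{rj} τ^j`. In these terms `pairing = p_k τ^k`, `devRate = c_k
τ^k + W^r ξ_r` with `c_k = ∇_k V^i p_i + Q_k`, and `devAccel = β_k τ^k + α^k ξ_k`; the last formula,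
`devAccel_eq`, is the long computation. So the relation means `α = A W` and `β = A c + B p`. When `Ω
≠ 0`, contraction of the first equality with `p` gives `A = α^s p_s / Ω`, so that `η = β - A c`. The
projector equations say exactly that `α` is a multiple of `W` and `η` a multiple of `p`
(`exists_linear_relation_iff`).

For the converse, off the zero section the coefficients can be solved for from two test variations,
hence are smooth along the trajectory within one chart. Admissible pairs `(A, B)` form a convex set
at each time, so a partition of unity glues the charts. A trajectory that meets the zero section
needs another argument, since the equations are assumed only for `𝐩 ≠ 0`. Letting `p` tend to `0`
along a coordinate axis, and using `n ≥ 2`, shows that `Θ` vanishes at `p = 0`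
(`snd_eq_zero_of_proportional`). Since `V` vanishes there too, the zero section consists of rest
points. By uniqueness such a trajectory stays in it, and its deviation functions are identically
zero. -/

noncomputable section

open scoped Topology

namespace NormalShift

set_option linter.unusedSectionVars false

/-! ### Smoothness of superposition operators on spaces of continuous functions. -/

section Superposition

set_option synthInstance.maxHeartbeats 200000
universe u

variable {K : Type*} [TopologicalSpace K] [CompactSpace K]

variable {W W' E : Type*} [NormedAddCommGroup W] [NormedSpace ℝ W] [NormedAddCommGroup W']
  [NormedSpace ℝ W'] [NormedAddCommGroup E] [NormedSpace ℝ E]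

/-- Pointwise application of a bounded bilinear map to continuous functions. -/
def pointwiseCLM (K : Type*) [TopologicalSpace K] [CompactSpace K] (b : E →L[ℝ] W →L[ℝ] W') :
    C(K, E) →L[ℝ] C(K, W) →L[ℝ] C(K, W') :=
  LinearMap.mkContinuous₂
    (LinearMap.mk₂ ℝ (fun (A : C(K, E)) (v : C(K, W)) =>
        (⟨fun r => b (A r) (v r), by fun_prop⟩ : C(K, W')))
      (fun A B v => by ext; simp) (fun c A v => by ext; simp)
      (fun A v w => by ext; simp) (fun c A v => by ext; simp)) ‖b‖
    (fun A v => by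
      rw [ContinuousMap.norm_le _ (by positivity)]
      intro r
      refine (b.le_opNorm₂ (A r) (v r)).trans ?_
      gcongr
      · exact A.norm_coe_le_norm r
      · exact v.norm_coe_le_norm r)

/-- The range of `u` is compact, so the derivative of `G` is uniformly continuous near it. The mean
value estimate for the remainder then holds with one `δ` for all points of `K`. -/
theorem hasFDerivAt_superposition (b : E →L[ℝ] W →L[ℝ] W')
    (G : C(W, W')) (G' : C(W, E)) (h : ∀ w, HasFDerivAt G (b (G' w)) w) (u : C(K, W)) :
    HasFDerivAt (fun u : C(K, W) => G.comp u) (pointwiseCLM K b (G'.comp u)) u := by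
  rw [hasFDerivAt_iff_isLittleO_nhds_zero, Asymptotics.isLittleO_iff]
  intro ε hε
  have hc : IsCompact (Set.range u) := isCompact_range u.continuous
  have hcont : Continuous fun w => b (G' w) := b.continuous.comp G'.continuous
  have hU := hc.uniformContinuousAt_of_continuousAt _ (fun a _ => hcont.continuousAt)
    (Metric.dist_mem_uniformity hε)
  obtain ⟨δ, hδ, hU⟩ := Metric.mem_uniformity_dist.1 hU
  filter_upwards [Metric.ball_mem_nhds (0 : C(K, W)) hδ] with v hv
  rw [ContinuousMap.norm_le _ (by positivity)]
  intro r
  have hvr : ‖v r‖ < δ := (v.norm_coe_le_norm r).trans_lt (by simpa using hv)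
  have key : ‖G (u r + v r) - G (u r) - b (G' (u r)) (u r + v r - u r)‖
      ≤ ε * ‖u r + v r - u r‖ := by
    refine (convex_ball (u r) δ).norm_image_sub_le_of_norm_hasFDerivWithin_le' (f := G)
      (f' := fun w => b (G' w)) (φ := b (G' (u r))) (fun w _ => (h w).hasFDerivWithinAt) ?_
      (Metric.mem_ball_self hδ) (by simpa using hvr)
    intro w hw
    have := hU (a := u r) (b := w) (by rw [dist_comm]; exact hw) ⟨r, rfl⟩
    have h2 : dist (b (G' (u r))) (b (G' w)) < ε := this
    rw [dist_comm, dist_eq_norm] at h2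
    exact h2.le
  simp only [add_sub_cancel_left] at key
  refine le_trans (b := ε * ‖v r‖) key ?_
  gcongr
  exact v.norm_coe_le_norm r

theorem contDiff_succ_superposition {n : ℕ} (b : E →L[ℝ] W →L[ℝ] W')
    (G : C(W, W')) (G' : C(W, E)) (h : ∀ w, HasFDerivAt G (b (G' w)) w)
    (hn : ContDiff ℝ n (fun u : C(K, W) => G'.comp u)) :
    ContDiff ℝ (n + 1) (fun u : C(K, W) => G.comp u) :=
  contDiff_succ_iff_hasFDerivAt.2
    ⟨_, (pointwiseCLM K b).contDiff.comp hn, hasFDerivAt_superposition b G G' h⟩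

/-- The derivative is again a superposition operator, by `fderiv ℝ G`, followed by a fixed bounded
bilinear map; this permits induction on `n`. The spaces are quantified inside the induction because
the target changes from `W'` to `W →L[ℝ] W'`, and they share a universe so that this new target is
admissible. -/
theorem contDiff_superposition (n : ℕ) : ∀ {W W' : Type u}
    [NormedAddCommGroup W] [NormedSpace ℝ W] [NormedAddCommGroup W'] [NormedSpace ℝ W']
    (G : C(W, W')), ContDiff ℝ n G → ContDiff ℝ n (fun u : C(K, W) => G.comp u) := by
  induction n with
  | zero =>
    intro W W' _ _ _ _ G _
    exact contDiff_zero.2 (ContinuousMap.continuous_postcomp G)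
  | succ n ih =>
    intro W W' _ _ _ _ G hG
    have hG' : ContDiff ℝ n (fderiv ℝ G) := hG.fderiv_right le_rfl
    have hd : Differentiable ℝ G := hG.differentiable (by simp)
    have hn := ih ⟨fderiv ℝ G, hG'.continuous⟩ hG'
    exact contDiff_succ_superposition (.id ℝ (W →L[ℝ] W')) G ⟨fderiv ℝ G, hG'.continuous⟩
      (fun w => (hd w).hasFDerivAt) hn

end Superposition

/-! ### Short-time flows and their smooth dependence on time and initial point. -/

section Flow

set_option synthInstance.maxHeartbeats 200000
open Set

variable {W : Type*} [NormedAddCommGroup W] [NormedSpace ℝ W] [CompleteSpace W]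

/-- The interval `[-1, 1]`. -/
abbrev SymmInterval : Type := Icc (-1 : ℝ) 1

/-- A continuous function on `[-1, 1]` extended to the line by constants. -/
def extendLine (u : C(SymmInterval, W)) (ρ : ℝ) : W := u (projIcc (-1) 1 (by norm_num) ρ)

theorem continuous_extendLine (u : C(SymmInterval, W)) : Continuous (extendLine u) :=
  u.continuous.comp continuous_projIcc

theorem extendLine_of_mem (u : C(SymmInterval, W)) (r : SymmInterval) :
    extendLine u r = u r := by
  simp [extendLine]

/-- Integration from `0`, as a bounded operator on `C([-1, 1], W)`. -/
def primitiveCLM (W : Type*) [NormedAddCommGroup W] [NormedSpace ℝ W] [CompleteSpace W] :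
    C(SymmInterval, W) →L[ℝ] C(SymmInterval, W) :=
  LinearMap.mkContinuous
    { toFun := fun u => ⟨fun r => ∫ ρ in (0 : ℝ)..r, extendLine u ρ,
        (intervalIntegral.continuous_primitive
          (fun a b => (continuous_extendLine u).intervalIntegrable a b) 0).comp
            continuous_subtype_val⟩
      map_add' := fun u v => by
        ext r
        exact intervalIntegral.integral_add ((continuous_extendLine u).intervalIntegrable _ _)
          ((continuous_extendLine v).intervalIntegrable _ _)
      map_smul' := fun c u => by
        ext r
        exact intervalIntegral.integral_smul c (extendLine u) } 1
    (fun u => by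
      rw [one_mul, ContinuousMap.norm_le _ (norm_nonneg _)]
      intro r
      have := intervalIntegral.norm_integral_le_of_norm_le_const (a := 0) (b := (r : ℝ))
        (f := extendLine u) (C := ‖u‖) (fun x _ => u.norm_coe_le_norm _)
      refine this.trans ?_
      have : |(r : ℝ) - 0| ≤ 1 := by
        rw [sub_zero, abs_le]; exact r.2
      nlinarith [norm_nonneg u])

theorem norm_primitiveCLM_le (u : C(SymmInterval, W)) : ‖primitiveCLM W u‖ ≤ ‖u‖ := by
  have := (primitiveCLM W).le_of_opNorm_le (LinearMap.mkContinuous_norm_le _ zero_le_one _) u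
  simpa using this

/-- The right-hand side of the integral equation `u = x + s ∫ G(u)`. -/
def picardMap (G : C(W, W)) (s : ℝ) (x : W) (u : C(SymmInterval, W)) : C(SymmInterval, W) :=
  ContinuousMap.const _ x + s • primitiveCLM W (G.comp u)

theorem contractingWith_picardMap {G : C(W, W)} {k : NNReal} (hG : LipschitzWith k G) {s : ℝ}
    (hs : ‖s‖₊ * k < 1) (x : W) : ContractingWith (‖s‖₊ * k) (picardMap G s x) := by
  refine ⟨hs, LipschitzWith.of_dist_le_mul fun u v => ?_⟩
  have h1 : picardMap G s x u - picardMap G s x v = s • primitiveCLM W (G.comp u - G.comp v) := by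
    simp [picardMap, smul_sub]
  rw [dist_eq_norm, h1, norm_smul]
  have h2 : ‖G.comp u - G.comp v‖ ≤ k * dist u v := by
    rw [ContinuousMap.norm_le _ (by positivity)]
    intro r
    have := hG.dist_le_mul (u r) (v r)
    rw [dist_eq_norm] at this
    refine this.trans ?_
    gcongr
    exact ContinuousMap.dist_apply_le_dist r
  calc ‖s‖ * ‖primitiveCLM W (G.comp u - G.comp v)‖ ≤ ‖s‖ * (k * dist u v) := by
        gcongr; exact (norm_primitiveCLM_le _).trans h2
    _ = _ := by push_cast; ring

open Classical in
/-- The solution `u` of `u = x + s ∫ G(u)` on `[-1, 1]`. -/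
def picardSolution (G : C(W, W)) (s : ℝ) (x : W) : C(SymmInterval, W) :=
  -- The value 0 is only a default: when `‖s‖ * k < 1` for a Lipschitz constant `k` of `G`, a fixed
  -- point exists and is unique.
  if h : ∃ u, picardMap G s x u = u then h.choose else 0

theorem picardMap_picardSolution {G : C(W, W)} {k : NNReal} (hG : LipschitzWith k G) {s : ℝ}
    (hs : ‖s‖₊ * k < 1) (x : W) : picardMap G s x (picardSolution G s x) = picardSolution G s x := by
  have h : ∃ u, picardMap G s x u = u :=
    ⟨_, (contractingWith_picardMap hG hs x).fixedPoint_isFixedPt⟩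
  rw [picardSolution, dif_pos h]
  exact h.choose_spec

theorem eq_picardSolution {G : C(W, W)} {k : NNReal} (hG : LipschitzWith k G) {s : ℝ}
    (hs : ‖s‖₊ * k < 1) (x : W) {u : C(SymmInterval, W)} (hu : picardMap G s x u = u) :
    u = picardSolution G s x :=
  (contractingWith_picardMap hG hs x).fixedPoint_unique' hu (picardMap_picardSolution hG hs x)

/-- The flow of `G` for short times. -/
def shortFlow (G : C(W, W)) (s : ℝ) (x : W) : W := picardSolution G s x ⟨1, by norm_num⟩

theorem picardSolution_apply {G : C(W, W)} {k : NNReal} (hG : LipschitzWith k G) {s : ℝ}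
    (hs : ‖s‖₊ * k < 1) (x : W) (r : SymmInterval) :
    picardSolution G s x r
      = x + s • ∫ ρ in (0 : ℝ)..r, G (extendLine (picardSolution G s x) ρ) := by
  conv_lhs => rw [← picardMap_picardSolution hG hs x]
  rfl

/-- If `u` solves the integral equation with parameter `s`, the rescaled curve `q ↦ u (r q)` solves
it with parameter `r s`. Uniqueness identifies the two, so a single solution on `[-1, 1]` carries
the flow for all times up to `|s|`. -/
theorem shortFlow_mul {G : C(W, W)} {k : NNReal} (hG : LipschitzWith k G) {s : ℝ}
    (hs : ‖s‖₊ * k < 1) (x : W) (r : SymmInterval) :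
    shortFlow G (r * s) x = picardSolution G s x r := by
  have hr : |(r : ℝ)| ≤ 1 := abs_le.2 r.2
  have hrs : ‖(r : ℝ) * s‖₊ * k < 1 := by
    refine lt_of_le_of_lt ?_ hs
    rw [nnnorm_mul]
    gcongr
    refine mul_le_of_le_one_left (by positivity) ?_
    exact_mod_cast hr
  let v : C(SymmInterval, W) :=
    ⟨fun q => extendLine (picardSolution G s x) (r * q),
      (continuous_extendLine _).comp (by fun_prop)⟩
  have hmem : ∀ q : SymmInterval, (r : ℝ) * q ∈ Icc (-1 : ℝ) 1 := fun q => by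
    rw [mem_Icc, ← abs_le, abs_mul]
    exact mul_le_one₀ hr (abs_nonneg _) (abs_le.2 q.2)
  have hv : picardMap G (r * s) x v = v := by
    ext q
    have h1 : v q = picardSolution G s x ⟨r * q, hmem q⟩ :=
      extendLine_of_mem (picardSolution G s x) ⟨r * q, hmem q⟩
    rw [h1, picardSolution_apply hG hs]
    change x + ((r : ℝ) * s) • (∫ ρ in (0 : ℝ)..q, extendLine (G.comp v) ρ) = _
    congr 1
    rw [mul_comm, mul_smul]
    congr 1
    have h2 : ∫ ρ in (0 : ℝ)..q, extendLine (G.comp v) ρ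
        = ∫ ρ in (0 : ℝ)..q, G (extendLine (picardSolution G s x) (r * ρ)) := by
      refine intervalIntegral.integral_congr fun ρ hρ => ?_
      have hρ' : ρ ∈ Icc (-1 : ℝ) 1 := by
        have := uIcc_subset_Icc (a₁ := (0 : ℝ)) (b₁ := (q : ℝ)) (a₂ := -1) (b₂ := 1)
          (by norm_num) q.2
        exact this hρ
      exact extendLine_of_mem (G.comp v) ⟨ρ, hρ'⟩
    rw [h2]
    have := intervalIntegral.smul_integral_comp_mul_left (a := 0) (b := (q : ℝ))
      (fun ρ => G (extendLine (picardSolution G s x) ρ)) (r : ℝ)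
    simpa using this
  have := eq_picardSolution hG hrs x hv
  rw [shortFlow, ← this]
  change extendLine (picardSolution G s x) (r * 1) = _
  rw [mul_one]
  exact extendLine_of_mem _ r

theorem shortFlow_zero {G : C(W, W)} {k : NNReal} (hG : LipschitzWith k G) (x : W) :
    shortFlow G 0 x = x := by
  have := picardSolution_apply hG (s := 0) (by simp) x ⟨1, by norm_num⟩
  simpa [shortFlow] using this

/-- Fix `S` slightly larger than `|s|` and still in the contraction range. For `|σ| < S` the flow at
time `σ` is an integral of one fixed continuous function with upper limit `σ / S`, and the
fundamental theorem of calculus applies. -/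
theorem hasDerivAt_shortFlow {G : C(W, W)} {k : NNReal} (hG : LipschitzWith k G) {s : ℝ}
    (hs : ‖s‖₊ * k < 1) (x : W) :
    HasDerivAt (fun s => shortFlow G s x) (G (shortFlow G s x)) s := by
  obtain ⟨S, hS, hSk⟩ : ∃ S : ℝ, |s| < S ∧ ‖S‖₊ * k < 1 := by
    have hc : Filter.Tendsto (fun ε : ℝ => ‖|s| + ε‖₊ * k) (𝓝[>] 0) (𝓝 (‖|s| + 0‖₊ * k)) :=
      ((by fun_prop : Continuous (fun ε : ℝ => ‖|s| + ε‖₊ * k)).tendsto 0).mono_left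
        nhdsWithin_le_nhds
    have h1 : ‖|s| + 0‖₊ * k < 1 := by
      rw [add_zero]
      have : ‖|s|‖₊ = ‖s‖₊ := by ext; simp
      rwa [this]
    obtain ⟨ε, h2, h3⟩ := ((hc.eventually (gt_mem_nhds h1)).and self_mem_nhdsWithin).exists
    exact ⟨|s| + ε, by simpa using h3, h2⟩
  have hS0 : 0 < S := (abs_nonneg s).trans_lt hS
  have hform : ∀ σ : ℝ, |σ| < S → shortFlow G σ x
      = x + S • ∫ ρ in (0 : ℝ)..(σ / S), G (extendLine (picardSolution G S x) ρ) := by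
    intro σ hσ
    have hm : σ / S ∈ Icc (-1 : ℝ) 1 := by
      rw [mem_Icc, ← abs_le, abs_div, abs_of_pos hS0, div_le_one hS0]; exact hσ.le
    have := shortFlow_mul hG hSk x ⟨σ / S, hm⟩
    rw [show ((⟨σ / S, hm⟩ : SymmInterval) : ℝ) * S = σ by field_simp] at this
    rw [this, picardSolution_apply hG hSk]
  have hm : s / S ∈ Icc (-1 : ℝ) 1 := by
    rw [mem_Icc, ← abs_le, abs_div, abs_of_pos hS0, div_le_one hS0]; exact hS.le
  have hval : extendLine (picardSolution G S x) (s / S) = shortFlow G s x := by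
    have := shortFlow_mul hG hSk x ⟨s / S, hm⟩
    rw [show ((⟨s / S, hm⟩ : SymmInterval) : ℝ) * S = s by field_simp] at this
    rw [this]
    exact extendLine_of_mem _ ⟨s / S, hm⟩
  have hcont : Continuous fun ρ => G (extendLine (picardSolution G S x) ρ) :=
    G.continuous.comp (continuous_extendLine _)
  have hd := intervalIntegral.integral_hasDerivAt_right (hcont.intervalIntegrable 0 (s / S))
    hcont.aestronglyMeasurable.stronglyMeasurableAtFilter hcont.continuousAt
  have hd2 := ((hd.scomp s ((hasDerivAt_id s).div_const S)).const_smul S).const_add x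
  rw [hval, smul_smul, mul_one_div_cancel hS0.ne', one_smul] at hd2
  refine hd2.congr_of_eventuallyEq ?_
  have : ∀ᶠ σ in 𝓝 s, |σ| < S := continuous_abs.continuousAt.eventually (gt_mem_nhds hS)
  filter_upwards [this] with σ hσ
  exact hform σ hσ

/-- Implicit function theorem for `u - x - s ∫ G(u) = 0` in `C([-1, 1], W)`; putting time into the
parameter `s` keeps the function space fixed. The partial derivative in `u` is `1 - T` with `‖T‖ ≤
|s| k < 1`, hence invertible. Uniqueness of the fixed point identifies the implicit function with
`picardSolution`. -/
theorem contDiffAt_shortFlow {G : C(W, W)} (hG' : ContDiff ℝ ∞ G) {k : NNReal}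
    (hG : LipschitzWith k G) {s : ℝ} (hs : ‖s‖₊ * k < 1) (x : W) :
    ContDiffAt ℝ ∞ (fun q : ℝ × W => shortFlow G q.1 q.2) (s, x) := by
  have hsup : ContDiff ℝ ∞ (fun u : C(SymmInterval, W) => G.comp u) :=
    contDiff_infty.2 fun n => contDiff_superposition n G (hG'.of_le (by exact_mod_cast le_top))
  let cst : W →L[ℝ] C(SymmInterval, W) := ContinuousLinearMap.const ℝ SymmInterval
  let Ψ : (ℝ × W) × C(SymmInterval, W) → C(SymmInterval, W) :=
    fun q => q.2 - (cst q.1.2 + q.1.1 • primitiveCLM W (G.comp q.2))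
  have hΨ : ContDiff ℝ ∞ Ψ := by
    have h1 : ContDiff ℝ ∞ fun q : (ℝ × W) × C(SymmInterval, W) => primitiveCLM W (G.comp q.2) :=
      (primitiveCLM W).contDiff.comp (hsup.comp contDiff_snd)
    exact contDiff_snd.sub ((cst.contDiff.comp (contDiff_snd.comp contDiff_fst)).add
      ((contDiff_fst.comp contDiff_fst).smul h1))
  set u := picardSolution G s x with hu
  let G' : C(W, W →L[ℝ] W) := ⟨fderiv ℝ G, (hG'.continuous_fderiv (by simp))⟩
  let T : C(SymmInterval, W) →L[ℝ] C(SymmInterval, W) :=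
    s • (primitiveCLM W ∘L pointwiseCLM SymmInterval (.id ℝ (W →L[ℝ] W)) (G'.comp u))
  have hT : ‖T‖ < 1 := by
    have hs' : ‖s‖ * k < 1 := by exact_mod_cast hs
    refine lt_of_le_of_lt (T.opNorm_le_bound (by positivity) fun v => ?_) hs'
    have h1 : ‖pointwiseCLM SymmInterval (.id ℝ (W →L[ℝ] W)) (G'.comp u) v‖ ≤ k * ‖v‖ := by
      rw [ContinuousMap.norm_le _ (by positivity)]
      intro r
      refine ((G' (u r)).le_opNorm (v r)).trans ?_
      gcongr
      · exact norm_fderiv_le_of_lipschitz ℝ hG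
      · exact v.norm_coe_le_norm r
    calc ‖T v‖ = ‖s‖ * ‖primitiveCLM W (pointwiseCLM SymmInterval (.id ℝ (W →L[ℝ] W)) (G'.comp u) v)‖ := by
          simp [T, norm_smul]
      _ ≤ ‖s‖ * (k * ‖v‖) := by gcongr; exact (norm_primitiveCLM_le _).trans h1
      _ = _ := by ring
  have hpart : fderiv ℝ Ψ ((s, x), u) ∘L .inr ℝ (ℝ × W) C(SymmInterval, W) = 1 - T := by
    have h1 : HasFDerivAt (fun v : C(SymmInterval, W) => Ψ ((s, x), v)) (1 - T) u := by
      have h2 := hasFDerivAt_superposition (K := SymmInterval) (.id ℝ (W →L[ℝ] W)) G G'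
        (fun w => ((hG'.differentiable (by simp)) w).hasFDerivAt) u
      have h3 := (((primitiveCLM W).hasFDerivAt.comp u h2).const_smul s).const_add (cst x)
      exact (hasFDerivAt_id u).sub h3
    have h4 : HasFDerivAt (fun v : C(SymmInterval, W) => Ψ ((s, x), v))
        (fderiv ℝ Ψ ((s, x), u) ∘L .inr ℝ (ℝ × W) C(SymmInterval, W)) u :=
      ((hΨ.differentiable (by simp)) ((s, x), u)).hasFDerivAt.comp u
        (hasFDerivAt_prodMk_right (s, x) u)
    exact h4.unique h1
  have hinv : (fderiv ℝ Ψ ((s, x), u) ∘L .inr ℝ (ℝ × W) C(SymmInterval, W)).IsInvertible := by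
    rw [hpart]
    exact ⟨ContinuousLinearEquiv.unitsEquiv ℝ _ (Units.oneSub T hT), by ext; rfl⟩
  have hcd : ContDiffAt ℝ ∞ Ψ ((s, x), u) := hΨ.contDiffAt
  have hΨ0 : Ψ ((s, x), u) = 0 :=
    sub_eq_zero.2 (picardMap_picardSolution hG hs x).symm
  have hsmooth := hcd.contDiffAt_implicitFunction (by simp) hinv
  have hev := hcd.eventually_apply_implicitFunction (by simp) hinv
  have hsk : ∀ᶠ q : ℝ × W in 𝓝 (s, x), ‖q.1‖₊ * k < 1 := by
    have : Continuous fun q : ℝ × W => ‖q.1‖₊ * k := by fun_prop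
    exact this.continuousAt.eventually (gt_mem_nhds hs)
  let ev : C(SymmInterval, W) →L[ℝ] W := ContinuousMap.evalCLM ℝ (⟨1, by norm_num⟩ : SymmInterval)
  refine (ev.contDiff.contDiffAt.comp (s, x) hsmooth).congr_of_eventuallyEq ?_
  filter_upwards [hev, hsk] with q hq hqk
  rw [hΨ0] at hq
  have := eq_picardSolution hG hqk q.2 (sub_eq_zero.1 hq).symm
  change picardSolution G q.1 q.2 _ = _
  rw [← this]
  rfl

end Flow

/-- Local flow of a smooth vector field: through every point there is a family of trajectories,
smooth in time and initial point. -/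
theorem exists_smooth_localFlow {W : Type*} [NormedAddCommGroup W] [NormedSpace ℝ W]
    [FiniteDimensional ℝ W] {O : Set W} (hO : IsOpen O) {G : W → W} (hG : ContDiffOn ℝ ∞ G O)
    {x₀ : W} (hx₀ : x₀ ∈ O) :
    ∃ (ε : ℝ) (D : Set W) (Φ : ℝ × W → W), 0 < ε ∧ IsOpen D ∧ x₀ ∈ D ∧
      ContDiffOn ℝ ∞ Φ (Set.Ioo (-ε) ε ×ˢ D) ∧
      (∀ x ∈ D, Φ (0, x) = x) ∧
      ∀ s ∈ Set.Ioo (-ε) ε, ∀ x ∈ D, Φ (s, x) ∈ O ∧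
        HasDerivAt (fun s => Φ (s, x)) (G (Φ (s, x))) s := by
  obtain ⟨r, hr, hrO⟩ := Metric.nhds_basis_closedBall.mem_iff.1 (hO.mem_nhds hx₀)
  -- The cut-off makes the field globally smooth and Lipschitz. For short times trajectories stay in
  -- the ball of radius `r / 2`, where `χ = 1` and the field is still `G`.
  let χ : ContDiffBump x₀ := ⟨r / 2, r, half_pos hr, half_lt_self hr⟩
  have hsmooth : ContDiff ℝ ∞ fun x => χ x • G x := by
    rw [contDiff_iff_contDiffAt]
    intro x
    by_cases hx : x ∈ O
    · exact χ.contDiff.contDiffAt.smul (hG.contDiffAt (hO.mem_nhds hx))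
    · have : (fun x => χ x • G x) =ᶠ[𝓝 x] fun _ => 0 := by
        have hx' : x ∈ (Metric.closedBall x₀ r)ᶜ := fun h => hx (hrO h)
        filter_upwards [Metric.isClosed_closedBall.isOpen_compl.mem_nhds hx'] with y hy
        have : χ y = 0 := χ.zero_of_le_dist (by
          have : ¬ dist y x₀ ≤ r := hy
          exact (not_le.1 this).le)
        rw [this, zero_smul]
      exact contDiffAt_const.congr_of_eventuallyEq this
  obtain ⟨k, hk⟩ := hsmooth.lipschitzWith_of_hasCompactSupport
    (χ.hasCompactSupport.smul_right) (by simp)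
  let H : C(W, W) := ⟨fun x => χ x • G x, hsmooth.continuous⟩
  replace hk : LipschitzWith k H := hk
  have hflow : ContDiffAt ℝ ∞ (fun q : ℝ × W => shortFlow H q.1 q.2) (0, x₀) :=
    contDiffAt_shortFlow hsmooth hk (by simp) x₀
  have hnear : ∀ᶠ q : ℝ × W in 𝓝 (0, x₀), shortFlow H q.1 q.2 ∈ Metric.ball x₀ (r / 2) :=
    hflow.continuousAt.eventually (Metric.isOpen_ball.mem_nhds (by
      simp only [shortFlow_zero hk x₀]; exact Metric.mem_ball_self (half_pos hr)))
  have hsk : ∀ᶠ q : ℝ × W in 𝓝 (0, x₀), ‖q.1‖₊ * k < 1 := by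
    have : Continuous fun q : ℝ × W => ‖q.1‖₊ * k := by fun_prop
    exact this.continuousAt.eventually (gt_mem_nhds (by simp))
  rw [nhds_prod_eq] at hnear hsk
  obtain ⟨A, hA, D, hD, hAD⟩ := Filter.mem_prod_iff.1 (hnear.and hsk)
  obtain ⟨ε, hε, hεA⟩ := Metric.mem_nhds_iff.1 hA
  rw [Real.ball_eq_Ioo, zero_sub, zero_add] at hεA
  have hboth : ∀ s ∈ Set.Ioo (-ε) ε, ∀ x ∈ interior D,
      shortFlow H s x ∈ Metric.ball x₀ (r / 2) ∧ ‖s‖₊ * k < 1 :=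
    fun s hs x hx => hAD (Set.mk_mem_prod (hεA hs) (interior_subset hx))
  refine ⟨ε, interior D, fun q => shortFlow H q.1 q.2, hε, isOpen_interior,
    mem_interior_iff_mem_nhds.2 hD, fun q hq => ?_, fun x _ => shortFlow_zero hk x,
    fun s hs x hx => ?_⟩
  · exact (contDiffAt_shortFlow hsmooth hk (hboth q.1 hq.1 q.2 hq.2).2 q.2).contDiffWithinAt
  · obtain ⟨h1, h2⟩ := hboth s hs x hx
    have h3 : shortFlow H s x ∈ O :=
      hrO (Metric.ball_subset_closedBall (Metric.ball_subset_ball (by linarith) h1))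
    refine ⟨h3, ?_⟩
    have h4 := hasDerivAt_shortFlow hk h2 x
    have h5 : H (shortFlow H s x) = G (shortFlow H s x) := by
      change χ _ • G _ = _
      rw [χ.one_of_mem_closedBall (Metric.ball_subset_closedBall h1), one_smul]
    rwa [h5] at h4

/-! ### The deviation function and its time derivatives in horizontal and vertical components. -/

section Deviation

variable {n : ℕ}

/-- `⟨𝐩 | τ⟩` for a variation `v = (τ, π)` of the point `z = (x, p)`. -/
def pairing (z v : Coord n × Coord n) : ℝ := ∑ k, z.2 k * v.1 k

/-- The time derivative of the deviation function, as a function of the point `z` and of the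
variation `v` of the trajectory of the field `G`. -/
def devRate (G : Coord n × Coord n → Coord n × Coord n) (z v : Coord n × Coord n) : ℝ :=
  ∑ k, ((G z).2 k * v.1 k + z.2 k * (fderiv ℝ G z v).1 k)

/-- The second time derivative of the deviation function. -/
def devAccel (G : Coord n × Coord n → Coord n × Coord n) (z v : Coord n × Coord n) : ℝ :=
  fderiv ℝ (fun w => devRate G w v) z (G z) + devRate G z (fderiv ℝ G z v)

/-- `N_{rj} = p_c Γ^c_{rj}`. -/
def nonlin (Γ : LocConn n) (r j : Fin n) (z : Coord n × Coord n) : ℝ := ∑ c, z.2 c * Γ c r j z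

/-- The vertical part of a variation `v` relative to the connection. -/
def vertPart (Γ : LocConn n) (z v : Coord n × Coord n) (r : Fin n) : ℝ :=
  v.2 r - ∑ j, nonlin Γ r j z * v.1 j

/-- The horizontal lift `∂/∂x^r + N_{rb} ∂/∂p_b` acting on functions. -/
def hd (Γ : LocConn n) (r : Fin n) (f : Coord n × Coord n → ℝ) (z : Coord n × Coord n) : ℝ :=
  dx r f z + ∑ b, nonlin Γ r b z * dp b f z

/-- The covariant derivative `∇_k V^i` as a scalar function. -/
def covV (Γ : LocConn n) (V : Fin n → Coord n × Coord n → ℝ) (k i : Fin n)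
    (z : Coord n × Coord n) : ℝ :=
  hd Γ k (V i) z + ∑ a, Γ i k a z * V a z

theorem hor_vec (Γ : LocConn n) (V : Fin n → Coord n × Coord n → ℝ) (i k : Fin n)
    (z : Coord n × Coord n) : hor Γ (vec V) ![i] ![k] z = covV Γ V k i z := by
  simp [hor, vec, covV, hd, nonlin, Finset.sum_mul]

theorem hor_vec_fun (Γ : LocConn n) (V : Fin n → Coord n × Coord n → ℝ) (I J : Fin 1 → Fin n) :
    hor Γ (vec V) I J = covV Γ V (J 0) (I 0) := by
  have hI : I = ![I 0] := by ext j; fin_cases j; rfl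
  have hJ : J = ![J 0] := by ext j; fin_cases j; rfl
  rw [hI, hJ]; funext z; exact hor_vec Γ V _ _ z

theorem hor_hor_vec (Γ : LocConn n) (V : Fin n → Coord n × Coord n → ℝ) (i r k : Fin n)
    (z : Coord n × Coord n) : hor Γ (hor Γ (vec V)) ![i] ![r, k] z
      = hd Γ r (covV Γ V k i) z + ∑ a, Γ i r a z * covV Γ V k a z
        - ∑ b, Γ b r k z * covV Γ V b i z := by
  rw [hor]
  simp [hor_vec_fun, hd, nonlin, Finset.sum_mul, Fin.tail]

theorem hor_vert_vec (Γ : LocConn n) (V : Fin n → Coord n × Coord n → ℝ) (i r k : Fin n)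
    (z : Coord n × Coord n) : hor Γ (vert (vec V)) ![k, i] ![r] z
      = hd Γ r (dp k (V i)) z + ∑ a, Γ k r a z * dp a (V i) z
        + ∑ a, Γ i r a z * dp k (V a) z := by
  simp [hor, vert, vec, hd, nonlin, Finset.sum_mul, Fin.tail, Fin.sum_univ_two, add_assoc]

theorem hor_covec (Γ : LocConn n) (Q : Fin n → Coord n × Coord n → ℝ) (r k : Fin n)
    (z : Coord n × Coord n) : hor Γ (covec Q) ![] ![r, k] z
      = hd Γ r (Q k) z - ∑ b, Γ b r k z * Q b z := by
  simp [hor, covec, hd, nonlin, Finset.sum_mul, Fin.tail]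

theorem vert_vec (V : Fin n → Coord n × Coord n → ℝ) (i k : Fin n) (z : Coord n × Coord n) :
    vert (vec V) ![k, i] ![] z = dp k (V i) z := by
  simp [vert, vec, Fin.tail]

theorem vert_vert_vec (V : Fin n → Coord n × Coord n → ℝ) (i k r : Fin n)
    (z : Coord n × Coord n) :
    vert (vert (vec V)) ![r, k, i] ![] z = dp r (dp k (V i)) z := by
  simp only [vert, vec, Fin.tail]
  rfl

theorem vert_hor_vec (Γ : LocConn n) (V : Fin n → Coord n × Coord n → ℝ) (i k r : Fin n)
    (z : Coord n × Coord n) :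
    vert (hor Γ (vec V)) ![r, i] ![k] z = dp r (covV Γ V k i) z := by
  simp only [vert, hor_vec_fun]
  rfl

theorem vert_covec (Q : Fin n → Coord n × Coord n → ℝ) (k r : Fin n) (z : Coord n × Coord n) :
    vert (covec Q) ![r] ![k] z = dp r (Q k) z := by
  simp only [vert, covec]
  rfl

theorem fieldW_eq (V : Fin n → Coord n × Coord n → ℝ) (s : Fin n) (z : Coord n × Coord n) :
    fieldW V s z = ∑ r, dp s (V r) z * z.2 r := by
  simp only [fieldW, vert_vec]

theorem force_add (Γ : LocConn n) (V Θ : Fin n → Coord n × Coord n → ℝ) (i : Fin n)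
    (z : Coord n × Coord n) : Θ i z = force Γ V Θ i z + ∑ j, nonlin Γ i j z * V j z := by
  have : ∑ j, nonlin Γ i j z * V j z = ∑ j, ∑ k, Γ k i j z * z.2 k * V j z := by
    simp only [nonlin, Finset.sum_mul, mul_comm (z.2 _)]
  rw [this, force, sub_add_cancel]

theorem fderiv_apply_eq_sum (f : Coord n × Coord n → ℝ) (z u : Coord n × Coord n) :
    fderiv ℝ f z u = ∑ s, u.1 s * dx s f z + ∑ s, u.2 s * dp s f z := by
  have h1 : u = ∑ s, u.1 s • ((Pi.single s 1, 0) : Coord n × Coord n)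
      + ∑ s, u.2 s • ((0, Pi.single s 1) : Coord n × Coord n) := by
    ext j
    · simp [Prod.fst_sum, Finset.sum_apply, Pi.single_apply]
    · simp [Prod.snd_sum, Finset.sum_apply, Pi.single_apply]
  conv_lhs => rw [h1]
  simp only [map_add, map_sum, map_smul, smul_eq_mul, dx, dp]

/-- The term `N_{sb} u^s ∂f/∂p_b` added in the horizontal lift is the one subtracted in the vertical
part, with the indices of `N` transposed; this is where symmetry of the connection enters. -/
theorem fderiv_apply_eq_hor_add_vert (Γ : LocConn n) {z : Coord n × Coord n}
    (hN : ∀ r j, nonlin Γ r j z = nonlin Γ j r z) (f : Coord n × Coord n → ℝ)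
    (u : Coord n × Coord n) :
    fderiv ℝ f z u = ∑ s, u.1 s * hd Γ s f z + ∑ s, vertPart Γ z u s * dp s f z := by
  rw [fderiv_apply_eq_sum]
  simp only [hd, vertPart, mul_add, sub_mul, Finset.sum_add_distrib, Finset.sum_sub_distrib,
    Finset.mul_sum, Finset.sum_mul]
  have : ∑ x, ∑ i, u.1 x * (nonlin Γ x i z * dp i f z)
      = ∑ x, ∑ i, nonlin Γ x i z * u.1 i * dp x f z := by
    rw [Finset.sum_comm]
    refine Finset.sum_congr rfl fun i _ => Finset.sum_congr rfl fun j _ => ?_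
    rw [hN j i]; ring
  rw [this]; ring

theorem sum_contract (A : Fin n → Fin n → ℝ) (v p V : Fin n → ℝ) :
    ∑ s, ∑ i, ∑ j, A s j * v i * p i * p s * V j
      = (∑ i, v i * p i) * ∑ j, (∑ s, p s * A s j) * V j := by
  simp only [Finset.sum_mul, Finset.mul_sum]
  rw [Finset.sum_congr rfl fun i _ => Finset.sum_comm, Finset.sum_comm]
  refine Finset.sum_congr rfl fun j _ => Finset.sum_congr rfl fun s _ =>
    Finset.sum_congr rfl fun i _ => ?_
  ring

/-- Pure index algebra, with all derivatives treated as independent arrays: a prefix `h` marks a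
horizontal derivative and `v` a momentum derivative. The left side is the expanded `α^k`, the right
side the coefficient of `ξ_k` produced by differentiating the rate. The `D` term comes from the
derivative of `N = p_c Γ^c` in the momenta. -/
theorem alpha_identity (k : Fin n) (p V Q W : Fin n → ℝ) (N C vV vQ hvV vvV : Fin n → Fin n → ℝ)
    (Γ D vN : Fin n → Fin n → Fin n → ℝ)
    (hW : ∀ r, W r = ∑ i, vV r i * p i) (hN : ∀ r j, N r j = ∑ c, p c * Γ c r j)
    (hΓ : ∀ k r j, Γ k r j = Γ k j r)
    (hvN : ∀ r j, vN k r j = Γ k r j - ∑ s, p s * D s r j) :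
    ∑ i, vV k i * Q i
      + ∑ r, ∑ i, (hvV r i + ∑ a, Γ k r a * vV a i + ∑ a, Γ i r a * vV k a) * p i * V r
      + ∑ r, ∑ i, vvV r i * p i * Q r
      + ∑ r, ∑ i, vV r i * p i * vQ k r
      - ∑ r, ∑ s, ∑ i, ∑ j, D s r j * vV r i * p i * p s * V j
      + ∑ r, ∑ i, C r i * p i * vV k r
      + ∑ r, vV k r * Q r
    = ∑ i, ((∑ s, V s * hvV s i + ∑ s, Q s * vvV s i) * p i
          + vV k i * (Q i + ∑ j, N i j * V j))
      + ∑ j, (Q j + ∑ i, C j i * p i) * vV k j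
      + ∑ r, W r * (vQ k r + ∑ j, vN k r j * V j) := by
  have e1 : ∑ r, ∑ i, (hvV r i + ∑ a, Γ k r a * vV a i + ∑ a, Γ i r a * vV k a) * p i * V r
      = ∑ i, (∑ s, V s * hvV s i) * p i + ∑ r, W r * ∑ j, Γ k r j * V j
        + ∑ i, vV k i * ∑ j, N i j * V j := by
    simp only [add_mul, Finset.sum_add_distrib, hW, hN, Finset.sum_mul, Finset.mul_sum]
    congr 1
    · congr 1
      · rw [Finset.sum_comm]
        refine Finset.sum_congr rfl fun i _ => Finset.sum_congr rfl fun j _ => ?_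
        ring
      · rw [Finset.sum_comm' (t' := Finset.univ) (s' := fun _ => Finset.univ) (by simp)]
        rw [Finset.sum_congr rfl fun i _ => Finset.sum_comm]
        rw [Finset.sum_comm]
        refine Finset.sum_congr rfl fun a _ => ?_
        rw [Finset.sum_comm]
        refine Finset.sum_congr rfl fun r _ => Finset.sum_congr rfl fun i _ => ?_
        rw [hΓ k r a]; ring
    · rw [Finset.sum_congr rfl fun i _ => Finset.sum_comm]
      rw [Finset.sum_comm]
      refine Finset.sum_congr rfl fun a _ => Finset.sum_congr rfl fun r _ =>
        Finset.sum_congr rfl fun i _ => ?_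
      rw [hΓ i r a]; ring
  have e2 : ∑ r, ∑ i, vvV r i * p i * Q r = ∑ i, (∑ s, Q s * vvV s i) * p i := by
    simp only [Finset.sum_mul]
    rw [Finset.sum_comm]
    refine Finset.sum_congr rfl fun i _ => Finset.sum_congr rfl fun j _ => ?_
    ring
  have e3 : ∑ r, ∑ i, vV r i * p i * vQ k r = ∑ r, W r * vQ k r := by
    simp only [hW, Finset.sum_mul]
  have e4 : ∑ r, ∑ s, ∑ i, ∑ j, D s r j * vV r i * p i * p s * V j
      = ∑ r, W r * ∑ j, (∑ s, p s * D s r j) * V j := by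
    refine Finset.sum_congr rfl fun r _ => ?_
    rw [hW]; exact sum_contract (fun s j => D s r j) _ p V
  have e5 : ∑ r, ∑ i, C r i * p i * vV k r = ∑ j, (∑ i, C j i * p i) * vV k j := by
    simp only [Finset.sum_mul]
  have e6 : ∑ r, Q r * vV k r = ∑ r, vV k r * Q r := by simp only [mul_comm]
  rw [e1, e2, e3, e4, e5]
  simp only [hvN, sub_mul, mul_add, mul_sub, add_mul, Finset.sum_add_distrib,
    Finset.sum_sub_distrib, e6]
  ring

/-- The counterpart for the coefficient of `τ^k`. The curvature `R` enters only through `hR`: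
contracted with `p` it is the antisymmetrized horizontal derivative of `N`. -/
theorem beta_identity (k : Fin n) (p V Q W hV : Fin n → ℝ)
    (N C hC vC vV vQ hQ vN : Fin n → Fin n → ℝ)
    (Γ D R hN' : Fin n → Fin n → Fin n → ℝ)
    (hW : ∀ r, W r = ∑ i, vV r i * p i) (hN : ∀ r j, N r j = ∑ c, p c * Γ c r j)
    (hΓ : ∀ k r j, Γ k r j = Γ k j r)
    (hhV : ∀ j, hV j = C k j - ∑ a, Γ j k a * V a)
    (hvN : ∀ s r, vN s r = Γ s r k - ∑ a, p a * D a s r)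
    (hR : ∀ r j, ∑ s, p s * R s r j = hN' j r k - hN' k r j) :
    ∑ r, ∑ i, (hC r i + ∑ a, Γ i r a * C k a - ∑ b, Γ b r k * C b i) * p i * V r
      + ∑ r, V r * (hQ r k - ∑ b, Γ b r k * Q b)
      + ∑ i, C k i * Q i
      + ∑ r, ∑ i, vC r i * p i * Q r
      + ∑ r, vQ r k * Q r
      + ∑ r, C k r * Q r
      + ∑ r, ∑ i, C r i * p i * C k r
      + ∑ r, ∑ i, vV r i * p i * (hQ k r - ∑ b, Γ b k r * Q b)
      - ∑ r, ∑ s, ∑ i, ∑ j,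
        (R s r j * vV r i * p i * p s * V j - D s j r * vV r i * p i * p s * Q j)
    = ∑ i, ((∑ s, V s * hC s i + ∑ s, Q s * vC s i) * p i
          + C k i * (Q i + ∑ j, N i j * V j))
      + (∑ s, V s * hQ s k + ∑ s, Q s * vQ s k)
      + ∑ j, (Q j + ∑ i, C j i * p i) * hV j
      + ∑ r, W r * (hQ k r + ∑ j, hN' k r j * V j
          - (∑ s, V s * hN' s r k + ∑ s, Q s * vN s r)) := by
  have e1 : ∑ r, ∑ i, (hC r i + ∑ a, Γ i r a * C k a - ∑ b, Γ b r k * C b i) * p i * V r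
      = ∑ i, (∑ s, V s * hC s i) * p i + ∑ i, C k i * ∑ j, N i j * V j
        - ∑ j, (∑ i, C j i * p i) * ∑ a, Γ j k a * V a := by
    simp only [add_mul, sub_mul, Finset.sum_add_distrib, Finset.sum_sub_distrib, hN,
      Finset.sum_mul, Finset.mul_sum]
    congr 1
    · congr 1
      · rw [Finset.sum_comm]
        refine Finset.sum_congr rfl fun i _ => Finset.sum_congr rfl fun j _ => ?_
        ring
      · rw [Finset.sum_congr rfl fun i _ => Finset.sum_comm]
        rw [Finset.sum_comm]
        refine Finset.sum_congr rfl fun a _ => Finset.sum_congr rfl fun r _ =>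
          Finset.sum_congr rfl fun i _ => ?_
        rw [hΓ i r a]; ring
    · rw [Finset.sum_congr rfl fun i _ => Finset.sum_comm]
      rw [Finset.sum_comm]
      refine Finset.sum_congr rfl fun a _ => Finset.sum_congr rfl fun r _ =>
        Finset.sum_congr rfl fun i _ => ?_
      rw [hΓ a r k]; ring
  have e2 : ∑ r, V r * (hQ r k - ∑ b, Γ b r k * Q b)
      = ∑ s, V s * hQ s k - ∑ j, Q j * ∑ a, Γ j k a * V a := by
    simp only [mul_sub, Finset.sum_sub_distrib, Finset.mul_sum]
    congr 1
    rw [Finset.sum_comm]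
    refine Finset.sum_congr rfl fun a _ => Finset.sum_congr rfl fun r _ => ?_
    rw [hΓ a r k]; ring
  have e3 : ∑ r, ∑ i, vC r i * p i * Q r = ∑ i, (∑ s, Q s * vC s i) * p i := by
    simp only [Finset.sum_mul]
    rw [Finset.sum_comm]
    refine Finset.sum_congr rfl fun i _ => Finset.sum_congr rfl fun j _ => ?_
    ring
  have e4 : ∑ r, ∑ i, vV r i * p i * (hQ k r - ∑ b, Γ b k r * Q b)
      = ∑ r, W r * hQ k r - ∑ r, W r * ∑ s, Γ s r k * Q s := by
    simp only [← Finset.sum_mul, ← hW, mul_sub, Finset.sum_sub_distrib, hΓ _ k _]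
  have e5 : ∑ r, ∑ s, ∑ i, ∑ j,
        (R s r j * vV r i * p i * p s * V j - D s j r * vV r i * p i * p s * Q j)
      = ∑ r, W r * ((∑ j, (∑ s, p s * R s r j) * V j) - ∑ j, (∑ s, p s * D s j r) * Q j) := by
    refine Finset.sum_congr rfl fun r _ => ?_
    rw [hW, mul_sub, ← sum_contract (fun s j => R s r j), ← sum_contract (fun s j => D s j r)]
    simp only [Finset.sum_sub_distrib]
  have e6 : ∑ r, ∑ i, C r i * p i * C k r = ∑ j, (∑ i, C j i * p i) * C k j := by
    simp only [Finset.sum_mul]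
  have e7 : ∑ r, Q r * C k r = ∑ r, C k r * Q r := by simp only [mul_comm]
  have e8 : ∑ r, vQ r k * Q r = ∑ r, Q r * vQ r k := by simp only [mul_comm]
  have e9 : ∀ r, ∑ x, hN' x r k * V x = ∑ x, V x * hN' x r k := fun r => by simp only [mul_comm]
  have e10 : ∀ r, ∑ x, Γ x r k * Q x = ∑ x, Q x * Γ x r k := fun r => by simp only [mul_comm]
  have e11 : ∀ r, ∑ x, (∑ s, p s * D s x r) * Q x = ∑ x, Q x * ∑ s, p s * D s x r :=
    fun r => by simp only [mul_comm]
  rw [e1, e2, e3, e4, e5, e6, e8]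
  simp only [hvN, hR, hhV, sub_mul, mul_add, mul_sub, add_mul, Finset.sum_add_distrib,
    Finset.sum_sub_distrib, e7, e9, e10, e11]
  ring

/-- `c_k = ∇_k V^i p_i + Q_k`, the coefficients of `τ^k` in the rate of the deviation function. -/
def rateCoeff (Γ : LocConn n) (V Q : Fin n → Coord n × Coord n → ℝ) (k : Fin n)
    (z : Coord n × Coord n) : ℝ :=
  Q k z + ∑ i, covV Γ V k i z * z.2 i

theorem fderiv_fst_apply {G : Coord n × Coord n → Coord n × Coord n} {z : Coord n × Coord n}
    (hG : DifferentiableAt ℝ G z) (v : Coord n × Coord n) (k : Fin n) :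
    (fderiv ℝ G z v).1 k = fderiv ℝ (fun w => (G w).1 k) z v := by
  have h : HasFDerivAt (fun w => (G w).1 k) (((ContinuousLinearMap.proj k).comp
      (ContinuousLinearMap.fst ℝ (Coord n) (Coord n))).comp (fderiv ℝ G z)) z :=
    (((ContinuousLinearMap.proj k).comp
      (ContinuousLinearMap.fst ℝ (Coord n) (Coord n))).hasFDerivAt).comp z hG.hasFDerivAt
  rw [h.fderiv]; rfl

theorem fderiv_snd_apply {G : Coord n × Coord n → Coord n × Coord n} {z : Coord n × Coord n}
    (hG : DifferentiableAt ℝ G z) (v : Coord n × Coord n) (k : Fin n) :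
    (fderiv ℝ G z v).2 k = fderiv ℝ (fun w => (G w).2 k) z v := by
  have h : HasFDerivAt (fun w => (G w).2 k) (((ContinuousLinearMap.proj k).comp
      (ContinuousLinearMap.snd ℝ (Coord n) (Coord n))).comp (fderiv ℝ G z)) z :=
    (((ContinuousLinearMap.proj k).comp
      (ContinuousLinearMap.snd ℝ (Coord n) (Coord n))).hasFDerivAt).comp z hG.hasFDerivAt
  rw [h.fderiv]; rfl

theorem nonlin_symm {Γ : LocConn n} {z : Coord n × Coord n}
    (hΓ : ∀ k i j, Γ k i j z = Γ k j i z) (r j : Fin n) : nonlin Γ r j z = nonlin Γ j r z := by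
  simp only [nonlin, hΓ _ r j]

/-- Write `Θ = Q + N V` and split `v`. The term `N_{kj} V^j = p_c Γ^c_{kj} V^j` is the Christoffel
part of `∇_k V^c p_c`, so it completes the horizontal derivative of `V` to a covariant one. -/
theorem devRate_eq {Γ : LocConn n} {z : Coord n × Coord n}
    (hΓ : ∀ k i j, Γ k i j z = Γ k j i z) {G : Coord n × Coord n → Coord n × Coord n}
    (hG : DifferentiableAt ℝ G z) (v : Coord n × Coord n) :
    devRate G z v =
      ∑ k, rateCoeff Γ (fun i w => (G w).1 i)
          (force Γ (fun i w => (G w).1 i) (fun i w => (G w).2 i)) k z * v.1 k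
        + ∑ r, fieldW (fun i w => (G w).1 i) r z * vertPart Γ z v r := by
  set V : Fin n → Coord n × Coord n → ℝ := fun i w => (G w).1 i with hV
  set Θ : Fin n → Coord n × Coord n → ℝ := fun i w => (G w).2 i with hΘ
  have h1 : ∀ k, (fderiv ℝ G z v).1 k
      = ∑ s, v.1 s * hd Γ s (V k) z + ∑ s, vertPart Γ z v s * dp s (V k) z := fun k => by
    rw [fderiv_fst_apply hG]
    exact fderiv_apply_eq_hor_add_vert Γ (nonlin_symm hΓ) _ v
  have h2 : ∀ k, (G z).2 k = force Γ V Θ k z + ∑ j, nonlin Γ k j z * V j z :=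
    fun k => force_add Γ V Θ k z
  simp only [devRate, h1, h2, rateCoeff, covV, fieldW_eq, nonlin, Finset.sum_add_distrib,
    add_mul, mul_add, Finset.sum_mul, Finset.mul_sum]
  have e1 : ∑ x, ∑ i, ∑ c, z.2 c * Γ c x i z * V i z * v.1 x
      = ∑ x, ∑ i, ∑ a, Γ i x a z * V a z * z.2 i * v.1 x := by
    refine Finset.sum_congr rfl fun x _ => ?_
    rw [Finset.sum_comm]
    refine Finset.sum_congr rfl fun i _ => Finset.sum_congr rfl fun j _ => ?_
    ring
  have e2 : ∑ x, ∑ i, z.2 x * (v.1 i * hd Γ i (V x) z)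
      = ∑ x, ∑ i, hd Γ x (V i) z * z.2 i * v.1 x := by
    rw [Finset.sum_comm]
    refine Finset.sum_congr rfl fun i _ => Finset.sum_congr rfl fun j _ => ?_
    ring
  have e3 : ∑ x, ∑ i, z.2 x * (vertPart Γ z v i * dp i (V x) z)
      = ∑ x, ∑ i, dp x (V i) z * z.2 i * vertPart Γ z v x := by
    rw [Finset.sum_comm]
    refine Finset.sum_congr rfl fun i _ => Finset.sum_congr rfl fun j _ => ?_
    ring
  rw [e1, e2, e3]
  ring

theorem fderiv_mul_apply {f g : Coord n × Coord n → ℝ} {z : Coord n × Coord n}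
    (hf : DifferentiableAt ℝ f z) (hg : DifferentiableAt ℝ g z) (u : Coord n × Coord n) :
    fderiv ℝ (fun w => f w * g w) z u = fderiv ℝ f z u * g z + f z * fderiv ℝ g z u := by
  change fderiv ℝ (f * g) z u = _
  rw [(hf.hasFDerivAt.mul hg.hasFDerivAt).fderiv]
  simp; ring

theorem fderiv_add_apply {f g : Coord n × Coord n → ℝ} {z : Coord n × Coord n}
    (hf : DifferentiableAt ℝ f z) (hg : DifferentiableAt ℝ g z) (u : Coord n × Coord n) :
    fderiv ℝ (fun w => f w + g w) z u = fderiv ℝ f z u + fderiv ℝ g z u := by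
  change fderiv ℝ (f + g) z u = _
  rw [(hf.hasFDerivAt.add hg.hasFDerivAt).fderiv]
  rfl

theorem fderiv_sub_apply {f g : Coord n × Coord n → ℝ} {z : Coord n × Coord n}
    (hf : DifferentiableAt ℝ f z) (hg : DifferentiableAt ℝ g z) (u : Coord n × Coord n) :
    fderiv ℝ (fun w => f w - g w) z u = fderiv ℝ f z u - fderiv ℝ g z u := by
  change fderiv ℝ (f - g) z u = _
  rw [(hf.hasFDerivAt.sub hg.hasFDerivAt).fderiv]
  rfl

theorem fderiv_mul_const_apply {f : Coord n × Coord n → ℝ} {z : Coord n × Coord n}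
    (hf : DifferentiableAt ℝ f z) (c : ℝ) (u : Coord n × Coord n) :
    fderiv ℝ (fun w => f w * c) z u = fderiv ℝ f z u * c := by
  rw [fderiv_mul_apply hf (differentiableAt_const c)]
  simp

theorem fderiv_sum_apply {ι : Type*} [Fintype ι] {f : ι → Coord n × Coord n → ℝ}
    {z : Coord n × Coord n} (hf : ∀ i, DifferentiableAt ℝ (f i) z) (u : Coord n × Coord n) :
    fderiv ℝ (fun w => ∑ i, f i w) z u = ∑ i, fderiv ℝ (f i) z u := by
  rw [(HasFDerivAt.fun_sum fun i (_ : i ∈ Finset.univ) => (hf i).hasFDerivAt).fderiv]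
  simp

theorem hasFDerivAt_momentum (i : Fin n) (z : Coord n × Coord n) :
    HasFDerivAt (fun w : Coord n × Coord n => w.2 i) (((ContinuousLinearMap.proj i).comp
      (ContinuousLinearMap.snd ℝ (Coord n) (Coord n)))) z :=
  ((ContinuousLinearMap.proj i).comp (ContinuousLinearMap.snd ℝ (Coord n) (Coord n))).hasFDerivAt

theorem fderiv_momentum_apply (i : Fin n) (z u : Coord n × Coord n) :
    fderiv ℝ (fun w : Coord n × Coord n => w.2 i) z u = u.2 i := by
  rw [(hasFDerivAt_momentum i z).fderiv]; rfl

theorem contDiffAt_momentum (i : Fin n) (z : Coord n × Coord n) :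
    ContDiffAt ℝ ∞ (fun w : Coord n × Coord n => w.2 i) z := by fun_prop

theorem fderiv_contract_apply {f : Fin n → Coord n × Coord n → ℝ} {z : Coord n × Coord n}
    (hf : ∀ i, DifferentiableAt ℝ (f i) z) (u : Coord n × Coord n) :
    fderiv ℝ (fun w => ∑ i, f i w * w.2 i) z u
      = ∑ i, (fderiv ℝ (f i) z u * z.2 i + f i z * u.2 i) := by
  rw [fderiv_sum_apply (f := fun i w => f i w * w.2 i)
    (fun i => (hf i).mul (hasFDerivAt_momentum i z).differentiableAt)]
  refine Finset.sum_congr rfl fun i _ => ?_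
  rw [fderiv_mul_apply (hf i) (hasFDerivAt_momentum i z).differentiableAt,
    fderiv_momentum_apply]

/-! ### Smoothness of the local expressions; derivatives of `p_c Γ^c` and curvature. -/

section Smooth

variable {z : Coord n × Coord n} {f : Coord n × Coord n → ℝ} {Γ : LocConn n}
  {V Θ : Fin n → Coord n × Coord n → ℝ}

theorem contDiffAt_dx (hf : ContDiffAt ℝ ∞ f z) (m : Fin n) : ContDiffAt ℝ ∞ (dx m f) z :=
  (hf.fderiv_right (m := ∞) (by simp)).clm_apply contDiffAt_const

theorem contDiffAt_dp (hf : ContDiffAt ℝ ∞ f z) (m : Fin n) : ContDiffAt ℝ ∞ (dp m f) z :=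
  (hf.fderiv_right (m := ∞) (by simp)).clm_apply contDiffAt_const

theorem contDiffAt_nonlin (hΓ : ∀ k i j, ContDiffAt ℝ ∞ (Γ k i j) z) (r j : Fin n) :
    ContDiffAt ℝ ∞ (nonlin Γ r j) z :=
  ContDiffAt.sum fun c _ => (contDiffAt_momentum c z).mul (hΓ c r j)

theorem contDiffAt_hd (hΓ : ∀ k i j, ContDiffAt ℝ ∞ (Γ k i j) z) (hf : ContDiffAt ℝ ∞ f z)
    (m : Fin n) : ContDiffAt ℝ ∞ (hd Γ m f) z :=
  (contDiffAt_dx hf m).add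
    (ContDiffAt.sum fun b _ => (contDiffAt_nonlin hΓ m b).mul (contDiffAt_dp hf b))

theorem contDiffAt_covV (hΓ : ∀ k i j, ContDiffAt ℝ ∞ (Γ k i j) z)
    (hV : ∀ i, ContDiffAt ℝ ∞ (V i) z) (k i : Fin n) : ContDiffAt ℝ ∞ (covV Γ V k i) z :=
  (contDiffAt_hd hΓ (hV i) k).add (ContDiffAt.sum fun a _ => (hΓ i k a).mul (hV a))

theorem contDiffAt_fieldW (hV : ∀ i, ContDiffAt ℝ ∞ (V i) z) (r : Fin n) :
    ContDiffAt ℝ ∞ (fieldW V r) z := by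
  have : fieldW V r = fun z => ∑ i, dp r (V i) z * z.2 i := funext (fieldW_eq V r)
  rw [this]
  exact ContDiffAt.sum fun i _ => (contDiffAt_dp (hV i) r).mul (contDiffAt_momentum i z)

theorem contDiffAt_force (hΓ : ∀ k i j, ContDiffAt ℝ ∞ (Γ k i j) z)
    (hV : ∀ i, ContDiffAt ℝ ∞ (V i) z) (hΘ : ∀ i, ContDiffAt ℝ ∞ (Θ i) z) (i : Fin n) :
    ContDiffAt ℝ ∞ (force Γ V Θ i) z :=
  (hΘ i).sub (ContDiffAt.sum fun j _ => ContDiffAt.sum fun k _ =>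
    ((hΓ k i j).mul (contDiffAt_momentum k z)).mul (hV j))

theorem dp_nonlin (hΓ : ∀ k i j, ContDiffAt ℝ ∞ (Γ k i j) z) (s r j : Fin n) :
    dp s (nonlin Γ r j) z = Γ s r j z - ∑ a, z.2 a * curvD Γ a s r j z := by
  have h : nonlin Γ r j = fun w => ∑ c, Γ c r j w * w.2 c := by
    funext w; simp only [nonlin, mul_comm]
  rw [dp, h, fderiv_contract_apply fun c => (hΓ c r j).differentiableAt (by simp)]
  simp only [Finset.sum_add_distrib, Pi.single_apply, mul_ite, mul_one, mul_zero,
    Finset.sum_ite_eq', Finset.mem_univ, if_true, curvD, dp, mul_neg, Finset.sum_neg_distrib,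
    sub_neg_eq_add]
  rw [add_comm]
  simp only [mul_comm]

/-- Leibniz rule for `p_c Γ^c_{rj}`, where the horizontal lift takes the function `p_c` to `N_{sc}`.
-/
theorem hd_nonlin (hΓ : ∀ k i j, ContDiffAt ℝ ∞ (Γ k i j) z) (s r j : Fin n) :
    hd Γ s (nonlin Γ r j) z
      = ∑ c, (z.2 c * hd Γ s (Γ c r j) z + nonlin Γ s c z * Γ c r j z) := by
  have h : nonlin Γ r j = fun w => ∑ c, Γ c r j w * w.2 c := by
    funext w; simp only [nonlin, mul_comm]
  have h1 : dx s (nonlin Γ r j) z = ∑ c, dx s (Γ c r j) z * z.2 c := by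
    rw [dx, h, fderiv_contract_apply fun c => (hΓ c r j).differentiableAt (by simp)]
    simp [dx]
  rw [hd, h1]
  simp only [dp_nonlin hΓ, hd, curvD, mul_neg, Finset.sum_neg_distrib, sub_neg_eq_add, mul_add,
    Finset.sum_add_distrib, Finset.mul_sum]
  have : ∑ x, ∑ i, nonlin Γ s x z * (z.2 i * dp x (Γ i r j) z)
      = ∑ x, ∑ i, z.2 x * (nonlin Γ s i z * dp i (Γ x r j) z) := by
    rw [Finset.sum_comm]
    refine Finset.sum_congr rfl fun i _ => Finset.sum_congr rfl fun j _ => ?_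
    ring
  rw [this]
  simp only [mul_comm (z.2 _) (dx _ _ _)]
  ring

/-- The quadratic terms of the curvature, contracted with `p`, are the terms `N_{sc} Γ^c` that arise
when the horizontal lift differentiates the factor `p_c` in `N`. -/
theorem sum_curvR (hΓ : ∀ k i j, ContDiffAt ℝ ∞ (Γ k i j) z)
    (hs : ∀ k i j, Γ k i j z = Γ k j i z) (r j k : Fin n) :
    ∑ s, z.2 s * curvR Γ s r j k z
      = hd Γ j (nonlin Γ k r) z - hd Γ k (nonlin Γ j r) z := by
  rw [hd_nonlin hΓ, hd_nonlin hΓ]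
  have h1 : ∀ s, curvR Γ s r j k z = hd Γ j (Γ s k r) z - hd Γ k (Γ s j r) z
      + ∑ m, Γ s j m z * Γ m k r z - ∑ m, Γ s k m z * Γ m j r z := by
    intro s
    simp only [curvR, hd, nonlin, Finset.sum_mul, hs _ j _, hs _ k _]
    ring
  have h2 : ∀ i l : Fin n, ∑ s, z.2 s * ∑ m, Γ s i m z * Γ m l r z
      = ∑ c, nonlin Γ i c z * Γ c l r z := by
    intro i l
    simp only [nonlin, Finset.mul_sum, Finset.sum_mul]
    rw [Finset.sum_comm]
    simp only [mul_assoc]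
  simp only [h1, mul_add, mul_sub, Finset.sum_add_distrib, Finset.sum_sub_distrib, h2]
  ring

end Smooth

/-- Bookkeeping for `φ''`: the first line differentiates the coefficients along the trajectory, the
rest differentiates the variation. The arrays `Xc`, `XW`, `XN` are derivatives along the field; `XN`
appears because the vertical part depends on the point through `N`. -/
theorem collect_identity (c W τ ξ V Xc XW : Fin n → ℝ) (XN hV vV hQ vQ : Fin n → Fin n → ℝ)
    (hN vN : Fin n → Fin n → Fin n → ℝ) :
    ∑ k, Xc k * τ k + ∑ r, (XW r * ξ r - W r * ∑ j, XN r j * τ j)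
      + (∑ k, c k * (∑ s, τ s * hV s k + ∑ s, ξ s * vV s k)
        + ∑ r, W r * (∑ s, τ s * hQ s r + ∑ s, ξ s * vQ s r
            + ∑ j, (∑ s, τ s * hN s r j + ∑ s, ξ s * vN s r j) * V j))
    = ∑ k, (Xc k + ∑ j, c j * hV k j
          + ∑ r, W r * (hQ k r + ∑ j, hN k r j * V j - XN r k)) * τ k
      + ∑ k, (XW k + ∑ j, c j * vV k j
          + ∑ r, W r * (vQ k r + ∑ j, vN k r j * V j)) * ξ k := by
  have sw : ∀ (a b : Fin n → ℝ) (A : Fin n → Fin n → ℝ),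
      ∑ k, a k * ∑ s, b s * A s k = ∑ k, (∑ j, a j * A k j) * b k := by
    intro a b A
    simp only [Finset.mul_sum, Finset.sum_mul]
    rw [Finset.sum_comm]
    refine Finset.sum_congr rfl fun i _ => Finset.sum_congr rfl fun j _ => ?_
    ring
  have sw3 : ∀ (b : Fin n → ℝ) (A : Fin n → Fin n → Fin n → ℝ),
      ∑ r, W r * ∑ j, (∑ s, b s * A s r j) * V j
        = ∑ k, (∑ r, W r * ∑ j, A k r j * V j) * b k := by
    intro b A
    rw [← sw W b (fun k r => ∑ j, A k r j * V j)]
    refine Finset.sum_congr rfl fun r _ => ?_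
    congr 1
    simp only [Finset.mul_sum, Finset.sum_mul]
    rw [Finset.sum_comm]
    simp only [mul_assoc]
  have sw2 : ∑ r, W r * ∑ j, XN r j * τ j = ∑ k, (∑ r, W r * XN r k) * τ k := by
    rw [← sw]; simp only [mul_comm]
  simp only [mul_add, add_mul, mul_sub, sub_mul, Finset.sum_add_distrib, Finset.sum_sub_distrib,
    sw, sw2, sw3]
  ring

/-! ### The second derivative of the deviation function in terms of `α` and `β`. -/

section Accel

variable {z : Coord n × Coord n} {Γ : LocConn n} {G : Coord n × Coord n → Coord n × Coord n}

theorem vertPart_field (Γ : LocConn n) (G : Coord n × Coord n → Coord n × Coord n)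
    (z : Coord n × Coord n) (s : Fin n) :
    vertPart Γ z (G z) s = force Γ (fun i w => (G w).1 i) (fun i w => (G w).2 i) s z := by
  rw [vertPart, sub_eq_iff_eq_add]
  exact force_add Γ (fun i w => (G w).1 i) (fun i w => (G w).2 i) s z

/-- Differentiate `Θ = Q + N V`: the terms `N · DV` are exactly what the vertical part subtracts. -/
theorem vertPart_fderiv (hG : ContDiffAt ℝ ∞ G z) (hΓ : ∀ k i j, ContDiffAt ℝ ∞ (Γ k i j) z)
    (v : Coord n × Coord n) (r : Fin n) :
    vertPart Γ z (fderiv ℝ G z v) r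
      = fderiv ℝ (force Γ (fun i w => (G w).1 i) (fun i w => (G w).2 i) r) z v
        + ∑ j, fderiv ℝ (nonlin Γ r j) z v * (G z).1 j := by
  have hGd : DifferentiableAt ℝ G z := hG.differentiableAt (by simp)
  have hV : ∀ i, ContDiffAt ℝ ∞ (fun w => (G w).1 i) z := fun i => by fun_prop
  have hΘ : ∀ i, ContDiffAt ℝ ∞ (fun w => (G w).2 i) z := fun i => by fun_prop
  have hQ := contDiffAt_force hΓ hV hΘ r
  have hN := contDiffAt_nonlin hΓ r
  have h1 : (fun w => (G w).2 r) = fun w =>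
      force Γ (fun i w => (G w).1 i) (fun i w => (G w).2 i) r w
        + ∑ j, nonlin Γ r j w * (G w).1 j :=
    funext fun w => force_add Γ (fun i w => (G w).1 i) (fun i w => (G w).2 i) r w
  have hd1 : ∀ j, DifferentiableAt ℝ (fun w => nonlin Γ r j w * (G w).1 j) z :=
    fun j => ((hN j).mul (hV j)).differentiableAt (by simp)
  rw [vertPart, fderiv_snd_apply hGd, h1, fderiv_add_apply (hQ.differentiableAt (by simp))
      (DifferentiableAt.fun_sum fun j _ => hd1 j), fderiv_sum_apply hd1]
  have h2 : ∀ j, fderiv ℝ (fun w => nonlin Γ r j w * (G w).1 j) z v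
      = fderiv ℝ (nonlin Γ r j) z v * (G z).1 j + nonlin Γ r j z * (fderiv ℝ G z v).1 j := by
    intro j
    rw [fderiv_mul_apply ((hN j).differentiableAt (by simp)) ((hV j).differentiableAt (by simp)),
      fderiv_fst_apply hGd]
  simp only [h2, Finset.sum_add_distrib]
  ring

/-- This is where `α` and `β` come from. Since `devAccel` itself does not involve `Γ`, the
connection serves only to organize the coefficients. -/
theorem devAccel_eq (hG : ContDiffAt ℝ ∞ G z) (hΓ : ∀ k i j, ContDiffAt ℝ ∞ (Γ k i j) z)
    (hs : ∀ᶠ w in 𝓝 z, ∀ k i j, Γ k i j w = Γ k j i w) (v : Coord n × Coord n) :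
    devAccel G z v =
      ∑ k, beta Γ (fun i w => (G w).1 i)
          (force Γ (fun i w => (G w).1 i) (fun i w => (G w).2 i)) k z * v.1 k
        + ∑ k, alpha Γ (fun i w => (G w).1 i)
          (force Γ (fun i w => (G w).1 i) (fun i w => (G w).2 i)) k z * vertPart Γ z v k := by
  have hGd : DifferentiableAt ℝ G z := hG.differentiableAt (by simp)
  set V : Fin n → Coord n × Coord n → ℝ := fun i w => (G w).1 i with hVdef
  set Θ : Fin n → Coord n × Coord n → ℝ := fun i w => (G w).2 i with hΘdef
  have hV : ∀ i, ContDiffAt ℝ ∞ (V i) z := fun i => by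
    simp only [hVdef]; fun_prop
  have hΘ : ∀ i, ContDiffAt ℝ ∞ (Θ i) z := fun i => by
    simp only [hΘdef]; fun_prop
  set Q := force Γ V Θ with hQdef
  have hQ : ∀ i, ContDiffAt ℝ ∞ (Q i) z := contDiffAt_force hΓ hV hΘ
  have hsz := hs.self_of_nhds
  have hNs := nonlin_symm hsz
  have hC := contDiffAt_covV hΓ hV
  have hW := contDiffAt_fieldW hV
  have hN := contDiffAt_nonlin hΓ
  have hc : ∀ k, ContDiffAt ℝ ∞ (rateCoeff Γ V Q k) z := fun k =>
    (hQ k).add (ContDiffAt.sum fun i _ => (hC k i).mul (contDiffAt_momentum i z))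
  have hX : ∀ f, fderiv ℝ f z (G z) = ∑ s, V s z * hd Γ s f z + ∑ s, Q s z * dp s f z := by
    intro f
    rw [fderiv_apply_eq_hor_add_vert Γ hNs]
    simp only [vertPart_field]
    rfl
  have hY : ∀ f, fderiv ℝ f z v = ∑ s, v.1 s * hd Γ s f z + ∑ s, vertPart Γ z v s * dp s f z :=
    fun f => fderiv_apply_eq_hor_add_vert Γ hNs f v
  have hGΘ : ∀ i, (G z).2 i = Q i z + ∑ j, nonlin Γ i j z * V j z := fun i => force_add Γ V Θ i z
  have hXc : ∀ k, fderiv ℝ (rateCoeff Γ V Q k) z (G z)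
      = ∑ i, ((∑ s, V s z * hd Γ s (covV Γ V k i) z + ∑ s, Q s z * dp s (covV Γ V k i) z) * z.2 i
          + covV Γ V k i z * (Q i z + ∑ j, nonlin Γ i j z * V j z))
        + (∑ s, V s z * hd Γ s (Q k) z + ∑ s, Q s z * dp s (Q k) z) := by
    intro k
    have h1 : rateCoeff Γ V Q k = fun z => Q k z + ∑ i, covV Γ V k i z * z.2 i := rfl
    have h2 : DifferentiableAt ℝ (fun z => ∑ i, covV Γ V k i z * z.2 i) z :=
      (ContDiffAt.sum fun i (_ : i ∈ Finset.univ) =>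
        (hC k i).mul (contDiffAt_momentum i z)).differentiableAt (by simp)
    rw [h1, fderiv_add_apply ((hQ k).differentiableAt (by simp)) h2,
      fderiv_contract_apply fun i => (hC k i).differentiableAt (by simp)]
    simp only [hX, hGΘ]
    rw [add_comm]
  have hXW : ∀ k, fderiv ℝ (fieldW V k) z (G z)
      = ∑ i, ((∑ s, V s z * hd Γ s (dp k (V i)) z + ∑ s, Q s z * dp s (dp k (V i)) z) * z.2 i
          + dp k (V i) z * (Q i z + ∑ j, nonlin Γ i j z * V j z)) := by
    intro k
    have h1 : fieldW V k = fun z => ∑ i, dp k (V i) z * z.2 i := funext (fieldW_eq V k)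
    rw [h1, fderiv_contract_apply fun i => (contDiffAt_dp (hV i) k).differentiableAt (by simp)]
    simp only [hX, hGΘ]
  have hvp : ∀ r, DifferentiableAt ℝ (fun w => vertPart Γ w v r) z := fun r =>
    ((contDiffAt_const.sub (ContDiffAt.sum fun j (_ : j ∈ Finset.univ) =>
      (hN r j).mul contDiffAt_const)).differentiableAt (n := ∞) (by simp))
  have hvp' : ∀ r, fderiv ℝ (fun w => vertPart Γ w v r) z (G z)
      = - ∑ j, fderiv ℝ (nonlin Γ r j) z (G z) * v.1 j := by
    intro r
    have h0 : ∀ j, DifferentiableAt ℝ (fun w => nonlin Γ r j w * v.1 j) z := fun j =>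
      ((hN r j).differentiableAt (by simp)).mul_const _
    have h1 : (fun w => vertPart Γ w v r) = fun w => v.2 r - ∑ j, nonlin Γ r j w * v.1 j := rfl
    rw [h1, fderiv_sub_apply (differentiableAt_const _) (DifferentiableAt.fun_sum fun j _ => h0 j),
      fderiv_sum_apply h0]
    simp [fderiv_mul_const_apply ((hN r _).differentiableAt (by simp))]
  have hrate : fderiv ℝ (fun w => devRate G w v) z (G z)
      = ∑ k, fderiv ℝ (rateCoeff Γ V Q k) z (G z) * v.1 k
        + ∑ r, (fderiv ℝ (fieldW V r) z (G z) * vertPart Γ z v r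
            - fieldW V r z * ∑ j, fderiv ℝ (nonlin Γ r j) z (G z) * v.1 j) := by
    have hev : (fun w => devRate G w v) =ᶠ[𝓝 z] fun w =>
        ∑ k, rateCoeff Γ V Q k w * v.1 k + ∑ r, fieldW V r w * vertPart Γ w v r := by
      have h1 : ContDiffAt ℝ 1 G z := hG.of_le (by exact_mod_cast le_top)
      filter_upwards [hs, h1.eventually (by simp)] with w hw hw'
      exact devRate_eq hw (hw'.differentiableAt (by simp)) v
    have h1 : ∀ k, DifferentiableAt ℝ (fun w => rateCoeff Γ V Q k w * v.1 k) z := fun k =>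
      ((hc k).differentiableAt (by simp)).mul_const _
    have h2 : ∀ r, DifferentiableAt ℝ (fun w => fieldW V r w * vertPart Γ w v r) z := fun r =>
      ((hW r).differentiableAt (by simp)).mul (hvp r)
    rw [hev.fderiv_eq, fderiv_add_apply (DifferentiableAt.fun_sum fun j _ => h1 j)
      (DifferentiableAt.fun_sum fun j _ => h2 j), fderiv_sum_apply h1, fderiv_sum_apply h2]
    congr 1
    · exact Finset.sum_congr rfl fun k _ =>
        fderiv_mul_const_apply ((hc k).differentiableAt (by simp)) _ _
    · refine Finset.sum_congr rfl fun r _ => ?_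
      rw [fderiv_mul_apply ((hW r).differentiableAt (by simp)) (hvp r), hvp']
      ring
  have hY1 : ∀ k, (fderiv ℝ G z v).1 k
      = ∑ s, v.1 s * hd Γ s (V k) z + ∑ s, vertPart Γ z v s * dp s (V k) z := fun k => by
    rw [fderiv_fst_apply hGd]; exact hY _
  rw [devAccel, hrate, devRate_eq hsz hGd]
  simp only [vertPart_fderiv hG hΓ]
  simp only [← hVdef, ← hΘdef, ← hQdef, hY1, hY, collect_identity]
  -- The symmetry of `Γ` is differentiated here, so it is needed near `z` and not only at `z`.
  have hsd : ∀ s r k, hd Γ s (nonlin Γ r k) z = hd Γ s (nonlin Γ k r) z := by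
    intro s r k
    have : nonlin Γ r k =ᶠ[𝓝 z] nonlin Γ k r := by
      filter_upwards [hs] with w hw
      exact nonlin_symm hw r k
    simp only [hd, dx, dp, this.fderiv_eq]
  congr 1
  · refine Finset.sum_congr rfl fun k _ => ?_
    congr 1
    have := beta_identity k z.2 (fun i => V i z) (fun i => Q i z) (fun i => fieldW V i z)
      (fun j => hd Γ k (V j) z) (fun r j => nonlin Γ r j z) (fun k i => covV Γ V k i z)
      (fun s i => hd Γ s (covV Γ V k i) z) (fun s i => dp s (covV Γ V k i) z)
      (fun r i => dp r (V i) z) (fun s r => dp s (Q r) z) (fun s r => hd Γ s (Q r) z)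
      (fun s r => dp s (nonlin Γ r k) z) (fun a b c => Γ a b c z)
      (fun a s r => curvD Γ a s r k z) (fun s r j => curvR Γ s r j k z)
      (fun s r j => hd Γ s (nonlin Γ r j) z) (fun r => fieldW_eq V r z) (fun r j => rfl)
      hsz (fun j => by simp only [covV]; ring) (fun s r => dp_nonlin hΓ s r k)
      (fun r j => by rw [sum_curvR hΓ hsz, hsd j k r, hsd k j r])
    simp only [beta, hor_hor_vec, hor_vec, hor_covec, vert_vec, vert_hor_vec, vert_covec]
    rw [this, hXc]
    simp only [hX]
    rfl
  · refine Finset.sum_congr rfl fun k _ => ?_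
    congr 1
    have := alpha_identity k z.2 (fun i => V i z) (fun i => Q i z) (fun i => fieldW V i z)
      (fun r j => nonlin Γ r j z) (fun k i => covV Γ V k i z)
      (fun r i => dp r (V i) z) (fun s r => dp s (Q r) z)
      (fun s i => hd Γ s (dp k (V i)) z) (fun s i => dp s (dp k (V i)) z)
      (fun a b c => Γ a b c z) (fun s r j => curvD Γ s k r j z)
      (fun k r j => dp k (nonlin Γ r j) z) (fun r => fieldW_eq V r z) (fun r j => rfl)
      hsz (fun r j => dp_nonlin hΓ k r j)
    simp only [alpha, hor_vert_vec, hor_vec, vert_vec, vert_vert_vec, vert_covec]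
    rw [this, hXW]
    rfl

end Accel

end Deviation

/-! ### The weak normality equations as linear algebra at a point. -/

section Pointwise

variable {n : ℕ} {z : Coord n × Coord n} {Γ : LocConn n}
  {G : Coord n × Coord n → Coord n × Coord n}

/-- Exhibits `η` as `β - A c` with `A = α^s p_s / Ω`: what remains of the acceleration form on
horizontal variations after the multiple of the rate is removed. -/
theorem eta_eq (Γ : LocConn n) (V Q : Fin n → Coord n × Coord n → ℝ) (k : Fin n)
    (z : Coord n × Coord n) :
    eta Γ V Q k z = beta Γ V Q k z
      - rateCoeff Γ V Q k z * ((∑ s, alpha Γ V Q s z * z.2 s) / Omega V z) := by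
  have h1 : ∑ i, ∑ s, covV Γ V k i z * z.2 i * alpha Γ V Q s z * z.2 s / Omega V z
      = (∑ i, covV Γ V k i z * z.2 i) * ((∑ s, alpha Γ V Q s z * z.2 s) / Omega V z) := by
    rw [Finset.sum_div, Finset.sum_mul_sum]
    exact Finset.sum_congr rfl fun i _ => Finset.sum_congr rfl fun s _ => by ring
  have h2 : ∑ s, Q k z * alpha Γ V Q s z * z.2 s / Omega V z
      = Q k z * ((∑ s, alpha Γ V Q s z * z.2 s) / Omega V z) := by
    rw [Finset.sum_div, Finset.mul_sum]
    exact Finset.sum_congr rfl fun s _ => by ring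
  simp only [eta, hor_vec, rateCoeff, h1, h2]
  ring

theorem sum_mul_projP_left (V : Fin n → Coord n × Coord n → ℝ) (a : Fin n → ℝ) (k : Fin n)
    (z : Coord n × Coord n) :
    ∑ r, a r * projP V k r z = a k - fieldW V k z * ((∑ r, a r * z.2 r) / Omega V z) := by
  simp only [projP, mul_sub, Finset.sum_sub_distrib, mul_ite, mul_one, mul_zero,
    Finset.sum_ite_eq, Finset.mem_univ, if_true, Finset.sum_div, Finset.mul_sum]
  congr 1
  exact Finset.sum_congr rfl fun r _ => by ring

theorem sum_mul_projP_right (V : Fin n → Coord n × Coord n → ℝ) (a : Fin n → ℝ) (k : Fin n)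
    (z : Coord n × Coord n) :
    ∑ r, a r * projP V r k z = a k - (∑ r, a r * fieldW V r z) / Omega V z * z.2 k := by
  simp only [projP, mul_sub, Finset.sum_sub_distrib, mul_ite, mul_one, mul_zero,
    Finset.sum_ite_eq', Finset.mem_univ, if_true, Finset.sum_div, Finset.sum_mul]
  congr 1
  exact Finset.sum_congr rfl fun r _ => by ring

/-- At a point with `Ω ≠ 0`, the weak normality equations say that the acceleration of the
deviation function is a linear combination of its rate and its value, for all variations. -/
theorem exists_linear_relation_iff (hG : ContDiffAt ℝ ∞ G z)
    (hΓ : ∀ k i j, ContDiffAt ℝ ∞ (Γ k i j) z)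
    (hs : ∀ᶠ w in 𝓝 z, ∀ k i j, Γ k i j w = Γ k j i w)
    (hΩ : Omega (fun i w => (G w).1 i) z ≠ 0) :
    (∃ A B : ℝ, ∀ v, devAccel G z v = A * devRate G z v + B * pairing z v) ↔
      ∀ k, ∑ r, alpha Γ (fun i w => (G w).1 i)
          (force Γ (fun i w => (G w).1 i) (fun i w => (G w).2 i)) r z
            * projP (fun i w => (G w).1 i) k r z = 0 ∧
        ∑ r, eta Γ (fun i w => (G w).1 i)
          (force Γ (fun i w => (G w).1 i) (fun i w => (G w).2 i)) r z
            * projP (fun i w => (G w).1 i) r k z = 0 := by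
  have hrate := devRate_eq hs.self_of_nhds (hG.differentiableAt (by simp))
  have haccel := devAccel_eq hG hΓ hs
  set V : Fin n → Coord n × Coord n → ℝ := fun i w => (G w).1 i
  set Q := force Γ V (fun i w => (G w).2 i)
  have hΩ' : ∑ s, fieldW V s z * z.2 s = Omega V z := by simp only [Omega, mul_comm]
  simp only [sum_mul_projP_left, sum_mul_projP_right]
  constructor
  · rintro ⟨A, B, h⟩
    have hα : ∀ k, alpha Γ V Q k z = A * fieldW V k z := by
      intro k
      -- A vertical test variation has zero pairing and sees only `α` and `W`.
      have := h (0, Pi.single k 1)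
      rw [haccel, hrate] at this
      simpa [pairing, vertPart, Pi.single_apply] using this
    have hβ : ∀ k, beta Γ V Q k z = A * rateCoeff Γ V Q k z + B * z.2 k := by
      intro k
      -- The momentum component is chosen so that the vertical part vanishes: a horizontal test
      -- variation.
      have := h (Pi.single k 1, fun r => nonlin Γ r k z)
      rw [haccel, hrate] at this
      simpa [pairing, vertPart, Pi.single_apply] using this
    have hA : (∑ s, alpha Γ V Q s z * z.2 s) / Omega V z = A := by
      simp only [hα, mul_assoc, ← Finset.mul_sum, hΩ']
      field_simp
    have hη : ∀ k, eta Γ V Q k z = B * z.2 k := by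
      intro k
      rw [eta_eq, hA, hβ]; ring
    intro k
    rw [hA, hα]
    refine ⟨by ring, ?_⟩
    simp only [hη, mul_assoc, ← Finset.mul_sum]
    have : ∑ i, z.2 i * fieldW V i z = Omega V z := rfl
    rw [this]
    field_simp
    ring
  · intro h
    refine ⟨(∑ s, alpha Γ V Q s z * z.2 s) / Omega V z,
      (∑ r, eta Γ V Q r z * fieldW V r z) / Omega V z, fun v => ?_⟩
    have hα : ∀ k, alpha Γ V Q k z
        = (∑ s, alpha Γ V Q s z * z.2 s) / Omega V z * fieldW V k z := fun k => by
      linarith [(h k).1]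
    have hβ : ∀ k, beta Γ V Q k z
        = (∑ s, alpha Γ V Q s z * z.2 s) / Omega V z * rateCoeff Γ V Q k z
          + (∑ r, eta Γ V Q r z * fieldW V r z) / Omega V z * z.2 k := fun k => by
      have h1 := (h k).2
      have h2 := eta_eq Γ V Q k z
      linarith
    rw [haccel, hrate, pairing]
    generalize (∑ s, alpha Γ V Q s z * z.2 s) / Omega V z = A at *
    generalize (∑ r, eta Γ V Q r z * fieldW V r z) / Omega V z = B at *
    simp only [hα, hβ, add_mul, mul_add, Finset.sum_add_distrib, Finset.mul_sum]
    simp only [mul_assoc]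
    ring

end Pointwise

/-! ### Derivatives along linearized trajectories, and the limit at the zero section. -/

section Family

variable {n : ℕ} {G : Coord n × Coord n → Coord n × Coord n}

theorem contDiffAt_devRate {q : (Coord n × Coord n) × (Coord n × Coord n)}
    (hG : ContDiffAt ℝ ∞ G q.1) :
    ContDiffAt ℝ ∞ (fun q : (Coord n × Coord n) × (Coord n × Coord n) => devRate G q.1 q.2) q := by
  have h1 : ContDiffAt ℝ ∞ (fun q : (Coord n × Coord n) × (Coord n × Coord n) => G q.1) q :=
    hG.comp q contDiffAt_fst
  have h2 : ContDiffAt ℝ ∞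
      (fun q : (Coord n × Coord n) × (Coord n × Coord n) => fderiv ℝ G q.1 q.2) q :=
    ((hG.fderiv_right (m := ∞) (by simp)).comp q contDiffAt_fst).clm_apply contDiffAt_snd
  unfold devRate
  refine ContDiffAt.sum fun k _ => ContDiffAt.add ?_ ?_
  · exact (show ContDiffAt ℝ ∞ (fun q => (G q.1).2 k) q by fun_prop).mul (by fun_prop)
  · exact ContDiffAt.mul (by fun_prop) (by fun_prop)

theorem contDiffAt_devAccel {q : (Coord n × Coord n) × (Coord n × Coord n)}
    (hG : ContDiffAt ℝ ∞ G q.1) :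
    ContDiffAt ℝ ∞ (fun q : (Coord n × Coord n) × (Coord n × Coord n) => devAccel G q.1 q.2) q := by
  have h1 : ContDiffAt ℝ ∞ (fun q : (Coord n × Coord n) × (Coord n × Coord n) => G q.1) q :=
    hG.comp q contDiffAt_fst
  have h2 : ContDiffAt ℝ ∞
      (fun q : (Coord n × Coord n) × (Coord n × Coord n) => fderiv ℝ G q.1 q.2) q :=
    ((hG.fderiv_right (m := ∞) (by simp)).comp q contDiffAt_fst).clm_apply contDiffAt_snd
  have h3 : ContDiffAt ℝ ∞ (fun q : (Coord n × Coord n) × (Coord n × Coord n) =>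
      fderiv ℝ (fun w => devRate G w q.2) q.1) q := by
    refine ContDiffAt.fderiv (n := ∞) (f := fun (q : (Coord n × Coord n) × (Coord n × Coord n)) w =>
      devRate G w q.2) ?_ contDiffAt_fst (by simp)
    exact ContDiffAt.comp
      (g := fun q : (Coord n × Coord n) × (Coord n × Coord n) => devRate G q.1 q.2)
      (f := fun r : ((Coord n × Coord n) × (Coord n × Coord n)) × (Coord n × Coord n) =>
        (r.2, r.1.2)) (q, q.1) (contDiffAt_devRate (q := (q.1, q.2)) hG)
      (contDiffAt_snd.prodMk (contDiffAt_snd.comp (q, q.1) contDiffAt_fst))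
  refine (h3.clm_apply h1).add ?_
  exact ContDiffAt.comp
    (g := fun q : (Coord n × Coord n) × (Coord n × Coord n) => devRate G q.1 q.2)
    (f := fun q => (q.1, fderiv ℝ G q.1 q.2)) q
    (contDiffAt_devRate (q := (q.1, fderiv ℝ G q.1 q.2)) hG) (contDiffAt_fst.prodMk h2)

theorem isLinearMap_devRate (G : Coord n × Coord n → Coord n × Coord n) (z : Coord n × Coord n) :
    IsLinearMap ℝ (devRate G z) where
  map_add u v := by
    simp only [devRate, map_add, Prod.fst_add, Pi.add_apply, mul_add, Finset.sum_add_distrib]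
    ring
  map_smul c v := by
    simp only [devRate, map_smul, Prod.smul_fst, Pi.smul_apply, smul_eq_mul, mul_add,
      Finset.sum_add_distrib, Finset.mul_sum, mul_left_comm]

theorem hasDerivAt_pairing {z v : ℝ → Coord n × Coord n} {v' : Coord n × Coord n} {t : ℝ}
    (hz : HasDerivAt z (G (z t)) t) (hv : HasDerivAt v v' t)
    (hv' : v' = fderiv ℝ G (z t) (v t)) :
    HasDerivAt (fun s => pairing (z s) (v s)) (devRate G (z t) (v t)) t := by
  subst hv'
  unfold pairing devRate
  refine HasDerivAt.fun_sum fun k _ => ?_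
  have h1 : HasDerivAt (fun s => (z s).2 k) ((G (z t)).2 k) t :=
    hasDerivAt_pi.1 ((hasFDerivAt_snd (𝕜 := ℝ)).comp_hasDerivAt t hz) k
  have h2 : HasDerivAt (fun s => (v s).1 k) ((fderiv ℝ G (z t) (v t)).1 k) t :=
    hasDerivAt_pi.1 ((hasFDerivAt_fst (𝕜 := ℝ)).comp_hasDerivAt t hv) k
  exact h1.mul h2

/-- The total derivative splits into a part in the point and a part in the variation. As `devRate`
is linear in the variation, the second part is `devRate` itself at the derivative of `v`. -/
theorem hasDerivAt_devRate {z v : ℝ → Coord n × Coord n} {t : ℝ}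
    (hG : ContDiffAt ℝ ∞ G (z t))
    (hz : HasDerivAt z (G (z t)) t) (hv : HasDerivAt v (fderiv ℝ G (z t) (v t)) t) :
    HasDerivAt (fun s => devRate G (z s) (v s)) (devAccel G (z t) (v t)) t := by
  have hd := ((contDiffAt_devRate (q := (z t, v t)) hG).differentiableAt (by simp)).hasFDerivAt
  have h1 := hd.comp_hasDerivAt t (hz.prodMk hv)
  refine h1.congr_deriv ?_
  have h2 : (G (z t), fderiv ℝ G (z t) (v t))
      = ((G (z t), 0) : (Coord n × Coord n) × (Coord n × Coord n))
        + (0, fderiv ℝ G (z t) (v t)) := by simp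
  rw [h2, map_add, devAccel]
  congr 1
  · have := HasFDerivAt.comp (f := fun w => (w, v t)) (z t) hd (hasFDerivAt_prodMk_left (z t) (v t))
    have h3 := this.fderiv
    change fderiv ℝ (fun w => devRate G w (v t)) (z t) = _ at h3
    rw [h3]; rfl
  · have := HasFDerivAt.comp (f := fun w => (z t, w)) (v t) hd (hasFDerivAt_prodMk_right (z t) (v t))
    have h4 : HasFDerivAt (devRate G (z t))
        ((isLinearMap_devRate G (z t)).mk' _).toContinuousLinearMap (v t) :=
      ((isLinearMap_devRate G (z t)).mk' _).toContinuousLinearMap.hasFDerivAt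
    have h5 := this.unique h4
    exact DFunLike.congr_fun h5 (fderiv ℝ G (z t) (v t))

/-- The variation of a family of trajectories satisfies the linearized equation. -/
theorem hasDerivAt_variation {W : Type*} [NormedAddCommGroup W] [NormedSpace ℝ W] {G : W → W}
    {f : ℝ × ℝ → W} {q : ℝ × ℝ} (hf : ContDiffAt ℝ ∞ f q) (hG : DifferentiableAt ℝ G (f q))
    (h : ∀ᶠ r : ℝ × ℝ in 𝓝 q, HasDerivAt (fun t => f (t, r.2)) (G (f r)) r.1) :
    HasDerivAt (fun t => fderiv ℝ f (t, q.2) (0, 1)) (fderiv ℝ G (f q) (fderiv ℝ f q (0, 1))) q.1 := by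
  have hd : DifferentiableAt ℝ (fderiv ℝ f) q :=
    (hf.fderiv_right (m := ∞) (by simp)).differentiableAt (by simp)
  have hline : HasDerivAt (fun t : ℝ => (t, q.2)) ((1, 0) : ℝ × ℝ) q.1 :=
    (hasDerivAt_id q.1).prodMk (hasDerivAt_const q.1 q.2)
  have h1 : HasDerivAt (fun t => fderiv ℝ f (t, q.2) (0, 1))
      (fderiv ℝ (fderiv ℝ f) q (1, 0) (0, 1)) q.1 := by
    have := hd.hasFDerivAt.comp_hasDerivAt q.1 (f := fun t : ℝ => (t, q.2)) hline
    simpa using this.clm_apply (hasDerivAt_const q.1 ((0, 1) : ℝ × ℝ))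
  -- Equality of mixed derivatives turns `∂_t ∂_y f` into `∂_y ∂_t f = ∂_y (G ∘ f)`.
  have hsymm : IsSymmSndFDerivAt ℝ f q := hf.isSymmSndFDerivAt (by
    rw [minSmoothness_of_isRCLikeNormedField]
    exact WithTop.coe_le_coe.2 (le_top : (2 : ℕ∞) ≤ ⊤))
  have hf1 : ContDiffAt ℝ 1 f q := hf.of_le (by exact_mod_cast le_top)
  have hev : (fun r => fderiv ℝ f r (1, 0)) =ᶠ[𝓝 q] fun r => G (f r) := by
    filter_upwards [h, hf1.eventually (by simp)] with r hr hr1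
    have h2 : HasDerivAt (fun t : ℝ => (t, r.2)) ((1, 0) : ℝ × ℝ) r.1 :=
      (hasDerivAt_id r.1).prodMk (hasDerivAt_const r.1 r.2)
    exact ((hr1.differentiableAt (by simp)).hasFDerivAt.comp_hasDerivAt r.1
      (f := fun t : ℝ => (t, r.2)) h2).unique hr
  have h3 : HasFDerivAt (fun r => fderiv ℝ f r (1, 0))
      (fderiv ℝ G (f q) ∘L fderiv ℝ f q) q :=
    (hG.hasFDerivAt.comp q (hf.differentiableAt (by simp)).hasFDerivAt).congr_of_eventuallyEq hev
  have h4 : HasFDerivAt (fun r => fderiv ℝ f r (1, 0))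
      ((ContinuousLinearMap.apply ℝ W ((1, 0) : ℝ × ℝ)) ∘L fderiv ℝ (fderiv ℝ f) q) q :=
    (ContinuousLinearMap.apply ℝ W ((1, 0) : ℝ × ℝ)).hasFDerivAt.comp q hd.hasFDerivAt
  have h5 := DFunLike.congr_fun (h4.unique h3) (0, 1)
  have h6 : fderiv ℝ (fderiv ℝ f) q (0, 1) (1, 0) = fderiv ℝ G (f q) (fderiv ℝ f q (0, 1)) := h5
  rw [← h6, hsymm.eq]
  exact h1

/-- If the acceleration of the deviation function is proportional to its rate for vertical
variations off the zero section, then the force vanishes on the zero section. -/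
theorem snd_eq_zero_of_proportional (hn : 2 ≤ n) {x : Coord n} (hG : ContDiffAt ℝ ∞ G (x, 0))
    (hsurj : ∀ w : Coord n, ∃ u : Coord n, (fderiv ℝ G (x, 0) (0, u)).1 = w)
    (h : ∀ p : Coord n, p ≠ 0 → ∃ A : ℝ, ∀ u : Coord n,
      devAccel G (x, p) (0, u) = A * devRate G (x, p) (0, u)) : (G (x, 0)).2 = 0 := by
  -- At `p = 0` every term that retains a factor `p` drops out. Both summands of `devAccel` leave
  -- the same sum, whence the factor 2.
  have hacc : ∀ u : Coord n, devAccel G (x, 0) (0, u)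
      = 2 * ∑ k, (fderiv ℝ G (x, 0) (0, u)).1 k * (G (x, 0)).2 k := by
    intro u
    have h1 : (fun w => devRate G w (0, u)) = fun w => ∑ k, (fderiv ℝ G w (0, u)).1 k * w.2 k := by
      funext w; simp [devRate, mul_comm]
    have h2 : ContDiffAt ℝ ∞ (fun w => fderiv ℝ G w (0, u)) (x, 0) :=
      (hG.fderiv_right (m := ∞) (by simp)).clm_apply contDiffAt_const
    rw [devAccel, h1, fderiv_contract_apply fun k =>
      (show ContDiffAt ℝ ∞ (fun w => (fderiv ℝ G w (0, u)).1 k) (x, 0) by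
        fun_prop).differentiableAt (by simp)]
    simp only [devRate, Pi.zero_apply, mul_zero, zero_mul, zero_add, add_zero, two_mul]
    congr 1
    exact Finset.sum_congr rfl fun k _ => mul_comm _ _
  have hlim : ∀ (j : Fin n) (u u' : Coord n),
      devAccel G (x, 0) (0, u) * (fderiv ℝ G (x, 0) (0, u')).1 j
        = devAccel G (x, 0) (0, u') * (fderiv ℝ G (x, 0) (0, u)).1 j := by
    intro j u u'
    -- Along the axis `e_j` the rate is `ε` times the `j`-th component of `∂V · u`. Eliminating `A`
    -- between `u` and `u'` cancels `ε` and leaves a relation that survives the limit `ε → 0`.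
    let c : ℝ → Coord n × Coord n := fun ε => (x, ε • Pi.single j 1)
    have hc : ContinuousAt c 0 := by fun_prop
    have hc0 : c 0 = (x, 0) := by simp [c]
    have hcacc : ∀ u, ContinuousAt (fun ε => devAccel G (c ε) (0, u)) 0 := by
      intro u
      have := (contDiffAt_devAccel (q := (c 0, (0, u))) (by rw [hc0]; exact hG)).continuousAt
      exact this.comp (f := fun ε => (c ε, ((0, u) : Coord n × Coord n)))
        (hc.prodMk continuousAt_const)
    have hcder : ∀ u, ContinuousAt (fun ε => (fderiv ℝ G (c ε) (0, u)).1 j) 0 := by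
      intro u
      have h2 : ContDiffAt ℝ ∞ (fun w => fderiv ℝ G w (0, u)) (c 0) := by
        rw [hc0]; exact (hG.fderiv_right (m := ∞) (by simp)).clm_apply contDiffAt_const
      have h3 : ContDiffAt ℝ ∞ (fun w => (fderiv ℝ G w (0, u)).1 j) (c 0) := by fun_prop
      exact ContinuousAt.comp (f := c) h3.continuousAt hc
    have hrate : ∀ ε u, devRate G (c ε) (0, u) = ε * (fderiv ℝ G (c ε) (0, u)).1 j := by
      intro ε u
      simp [devRate, c, Pi.single_apply]
    have hne : ∀ᶠ ε in 𝓝[≠] (0 : ℝ),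
        devAccel G (c ε) (0, u) * (fderiv ℝ G (c ε) (0, u')).1 j
          = devAccel G (c ε) (0, u') * (fderiv ℝ G (c ε) (0, u)).1 j := by
      filter_upwards [self_mem_nhdsWithin] with ε hε
      have hp : ε • (Pi.single j 1 : Coord n) ≠ 0 := smul_ne_zero hε (by simp)
      obtain ⟨A, hA⟩ := h _ hp
      change ∀ u, devAccel G (c ε) (0, u) = A * devRate G (c ε) (0, u) at hA
      rw [hA, hA, hrate, hrate]; ring
    have l1 := (((hcacc u).mul (hcder u')).tendsto).mono_left
      (nhdsWithin_le_nhds (s := {0}ᶜ))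
    have l2 := (((hcacc u').mul (hcder u)).tendsto).mono_left
      (nhdsWithin_le_nhds (s := {0}ᶜ))
    have := tendsto_nhds_unique (l1.congr' hne) l2
    simpa only [Pi.mul_apply, hc0] using this
  funext i
  -- A second index is available because `n ≥ 2`. With `∂V · u = e_i` and `∂V · u' = e_j` the
  -- limiting relation reads `2 Θ_i = 0`.
  obtain ⟨j, hj⟩ : ∃ j : Fin n, j ≠ i := by
    have : Nontrivial (Fin n) := Fin.nontrivial_iff_two_le.2 hn
    exact exists_ne i
  obtain ⟨u, hu⟩ := hsurj (Pi.single i 1)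
  obtain ⟨u', hu'⟩ := hsurj (Pi.single j 1)
  have := hlim j u u'
  rw [hacc, hacc, hu, hu'] at this
  simpa [Pi.single_apply, hj] using this

end Family

/-! ### Canonical coordinates on `T*M` and their smoothness. -/

section Chart

variable {n : ℕ} {M : Type*} [TopologicalSpace M] [ChartedSpace (Coord n) M]
  [IsManifold (baseModel n) ∞ M] {φ : OpenPartialHomeomorph M (Coord n)}

theorem contMDiffAt_chart (hφ : φ ∈ IsManifold.maximalAtlas (baseModel n) ∞ M) {m : M}
    (hm : m ∈ φ.source) : ContMDiffAt (baseModel n) (baseModel n) ∞ φ m :=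
  contMDiffAt_of_mem_maximalAtlas hφ hm

theorem contMDiffAt_chart_symm (hφ : φ ∈ IsManifold.maximalAtlas (baseModel n) ∞ M) {x : Coord n}
    (hx : x ∈ φ.target) : ContMDiffAt (baseModel n) (baseModel n) ∞ φ.symm x :=
  contMDiffAt_symm_of_mem_maximalAtlas hφ hx

theorem mdifferentiable_chart (hφ : φ ∈ IsManifold.maximalAtlas (baseModel n) ∞ M) :
    φ.MDifferentiable (baseModel n) (baseModel n) :=
  ⟨(contMDiffOn_of_mem_maximalAtlas hφ).mdifferentiableOn (by simp),
    (contMDiffOn_symm_of_mem_maximalAtlas hφ).mdifferentiableOn (by simp)⟩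

/-- The differential of a chart, as a linear isomorphism. -/
def chartEquiv (hφ : φ ∈ IsManifold.maximalAtlas (baseModel n) ∞ M) {m : M} (hm : m ∈ φ.source) :
    TangentSpace (baseModel n) m ≃L[ℝ] Coord n :=
  (mdifferentiable_chart hφ).mfderiv hm

theorem coe_chartEquiv (hφ : φ ∈ IsManifold.maximalAtlas (baseModel n) ∞ M) {m : M}
    (hm : m ∈ φ.source) : (chartEquiv hφ hm : TangentSpace (baseModel n) m →L[ℝ] Coord n)
      = chartDeriv φ m := rfl

theorem inverse_chartDeriv (hφ : φ ∈ IsManifold.maximalAtlas (baseModel n) ∞ M) {m : M}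
    (hm : m ∈ φ.source) : (chartDeriv φ m).inverse = (chartEquiv hφ hm).symm := by
  rw [← coe_chartEquiv hφ hm, ContinuousLinearMap.inverse_equiv]

theorem inverse_chartDeriv_eq_mfderiv (hφ : φ ∈ IsManifold.maximalAtlas (baseModel n) ∞ M) {m : M}
    (hm : m ∈ φ.source) :
    (chartDeriv φ m).inverse = mfderiv (baseModel n) (baseModel n) φ.symm (φ m) := by
  rw [inverse_chartDeriv hφ hm]; rfl

theorem apply_eq_sum_coords (hφ : φ ∈ IsManifold.maximalAtlas (baseModel n) ∞ M)
    {q : CotangentBundle n M} (hq : q.proj ∈ φ.source) (v : TangentSpace (baseModel n) q.proj) :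
    q.2 v = ∑ i, (coords φ q).2 i * chartDeriv φ q.proj v i := by
  have h1 : v = (chartDeriv φ q.proj).inverse (chartDeriv φ q.proj v) := by
    rw [inverse_chartDeriv hφ hq, ← coe_chartEquiv hφ hq]; simp
  have h2 : chartDeriv φ q.proj v
      = ∑ i, chartDeriv φ q.proj v i • (Pi.single i 1 : Coord n) := by
    ext j; simp [Finset.sum_apply, Pi.single_apply]
  conv_lhs => rw [h1, h2]
  rw [map_sum, map_sum]
  refine Finset.sum_congr rfl fun i _ => ?_
  rw [map_smul, map_smul, smul_eq_mul, mul_comm]; rfl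

theorem coords_ofCoords (hφ : φ ∈ IsManifold.maximalAtlas (baseModel n) ∞ M)
    {z : Coord n × Coord n} (hz : z.1 ∈ φ.target) : coords φ (ofCoords φ z) = z := by
  have hm : (ofCoords φ z).proj ∈ φ.source := φ.map_target hz
  ext i
  · exact congrFun (φ.right_inv hz) i
  · change (ofCoords φ z).2 ((chartDeriv φ (ofCoords φ z).proj).inverse (Pi.single i 1)) = _
    rw [inverse_chartDeriv hφ hm]
    change (∑ j : Fin n, z.2 j • (ContinuousLinearMap.proj j : Coord n →L[ℝ] ℝ).comp
      (chartDeriv φ (φ.symm z.1))) ((chartEquiv hφ hm).symm (Pi.single i 1)) = _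
    have : chartDeriv φ (φ.symm z.1) ((chartEquiv hφ hm).symm (Pi.single i 1))
      = Pi.single i 1 := (chartEquiv hφ hm).apply_symm_apply _
    have h2 : ∀ u : TangentSpace (baseModel n) (φ.symm z.1), (∑ j : Fin n, z.2 j •
        (ContinuousLinearMap.proj j : Coord n →L[ℝ] ℝ).comp (chartDeriv φ (φ.symm z.1))) u
          = ∑ j, z.2 j * chartDeriv φ (φ.symm z.1) u j := fun u => by simp
    refine (h2 _).trans ?_
    rw [this]
    simp [Pi.single_apply]

theorem ofCoords_coords (hφ : φ ∈ IsManifold.maximalAtlas (baseModel n) ∞ M)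
    {q : CotangentBundle n M} (hq : q.proj ∈ φ.source) : ofCoords φ (coords φ q) = q := by
  obtain ⟨m, p⟩ := q
  have h1 : φ.symm (φ m) = m := φ.left_inv hq
  -- The base point is generalized because the type of the covector depends on it.
  have h2 : ∀ m', m' = m → (⟨m', ∑ i : Fin n, (coords φ (⟨m, p⟩ : CotangentBundle n M)).2 i •
    (ContinuousLinearMap.proj i : Coord n →L[ℝ] ℝ).comp (chartDeriv φ m')⟩ : CotangentBundle n M)
      = ⟨m, p⟩ := by
    rintro _ rfl
    congr 1
    ext v
    rw [apply_eq_sum_coords hφ hq v]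
    simp
  exact h2 _ h1


/-- The coordinate `p_i` is the pairing of the covector with the field `∂/∂x^i`. That field is
smooth, as the tangent map of `φ.symm` on a constant vector, and the pairing of bundles is smooth.
-/
theorem contMDiffAt_coords (hφ : φ ∈ IsManifold.maximalAtlas (baseModel n) ∞ M)
    {q : CotangentBundle n M} (hq : q.proj ∈ φ.source) :
    ContMDiffAt (cotangentModel n) 𝓘(ℝ, Coord n × Coord n) ∞ (coords φ) q := by
  have hproj : ContMDiffAt (cotangentModel n) (baseModel n) ∞
      (Bundle.TotalSpace.proj : CotangentBundle n M → M) q := Bundle.contMDiffAt_proj _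
  have h1 : ContMDiffAt (cotangentModel n) (baseModel n) ∞
      (fun q : CotangentBundle n M => φ q.proj) q := (contMDiffAt_chart hφ hq).comp q hproj
  have h2 : ∀ i, ContMDiffAt (cotangentModel n) 𝓘(ℝ, ℝ) ∞
      (fun q : CotangentBundle n M => q.2 ((chartDeriv φ q.proj).inverse (Pi.single i 1))) q := by
    intro i
    have hv : ContMDiffAt (cotangentModel n) (baseModel n).tangent ∞
        (fun q : CotangentBundle n M => (⟨q.proj, (chartDeriv φ q.proj).inverse (Pi.single i 1)⟩ :
          TangentBundle (baseModel n) M)) q := by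
      have h3 : ContMDiffAt (baseModel n).tangent (baseModel n).tangent ∞
          (tangentMapWithin (baseModel n) (baseModel n) φ.symm φ.target)
            (⟨φ q.proj, Pi.single i 1⟩ : TangentBundle (baseModel n) (Coord n)) := by
        have h4 := (contMDiffOn_symm_of_mem_maximalAtlas hφ).contMDiffOn_tangentMapWithin
          (m := ∞) (by simp) φ.open_target.uniqueMDiffOn
        refine h4.contMDiffAt ?_
        exact (φ.open_target.preimage (FiberBundle.continuous_proj _ _)).mem_nhds
          (φ.map_source hq)
      have h5 : ContMDiffAt (cotangentModel n) (baseModel n).tangent ∞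
        (fun q : CotangentBundle n M => (⟨φ q.proj, Pi.single i 1⟩ :
          TangentBundle (baseModel n) (Coord n))) q := by
        rw [Bundle.contMDiffAt_totalSpace]
        refine ⟨h1, ?_⟩
        simpa using contMDiffAt_const
      refine (h3.comp q h5).congr_of_eventuallyEq ?_
      have : ∀ᶠ r : CotangentBundle n M in 𝓝 q, r.proj ∈ φ.source :=
        hproj.continuousAt.eventually (φ.open_source.mem_nhds hq)
      filter_upwards [this] with r hr
      refine Bundle.TotalSpace.ext (φ.left_inv hr).symm (heq_of_eq ?_)
      change (chartDeriv φ r.proj).inverse (Pi.single i 1)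
        = mfderivWithin (baseModel n) (baseModel n) φ.symm φ.target (φ r.proj) (Pi.single i 1)
      rw [inverse_chartDeriv_eq_mfderiv hφ hr,
        mfderivWithin_of_isOpen φ.open_target (φ.map_source hr)]
      rfl
    have h6 := ContMDiffAt.clm_bundle_apply (F₁ := Coord n) (F₂ := ℝ) (E₂ := Bundle.Trivial M ℝ)
      (n := ∞) (IM := cotangentModel n)
      (ϕ := fun q : CotangentBundle n M => q.2) (b := fun q : CotangentBundle n M => q.proj)
      (x := q) contMDiffAt_id hv
    rw [Bundle.contMDiffAt_totalSpace] at h6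
    simpa using h6.2
  rw [contMDiffAt_prod_module_iff]
  exact ⟨h1, contMDiffAt_pi_space.2 h2⟩

theorem contMDiffAt_ofCoords (hφ : φ ∈ IsManifold.maximalAtlas (baseModel n) ∞ M)
    {z : Coord n × Coord n} (hz : z.1 ∈ φ.target) :
    ContMDiffAt 𝓘(ℝ, Coord n × Coord n) (cotangentModel n) ∞
      (ofCoords φ : Coord n × Coord n → CotangentBundle n M) z := by
  have hfst : ContMDiffAt 𝓘(ℝ, Coord n × Coord n) (baseModel n) ∞
      (fun z : Coord n × Coord n => φ.symm z.1) z :=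
    (contMDiffAt_chart_symm hφ hz).comp z contDiffAt_fst.contMDiffAt
  rw [contMDiffAt_hom_bundle]
  refine ⟨hfst, ?_⟩
  have h1 := (contMDiffAt_chart hφ (φ.map_target hz)).mfderiv_const (m := ∞) (by simp)
  have h2 := h1.comp z hfst
  have h3 : ContMDiffAt 𝓘(ℝ, Coord n × Coord n) 𝓘(ℝ, Coord n →L[ℝ] ℝ) ∞
    (fun z : Coord n × Coord n => ∑ i, z.2 i • (ContinuousLinearMap.proj i : Coord n →L[ℝ] ℝ)) z :=
    ContDiffAt.contMDiffAt (by fun_prop)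
  refine (h3.clm_comp h2).congr_of_eventuallyEq (Filter.Eventually.of_forall fun w => ?_)
  ext v
  simp [inTangentCoordinates, ContinuousLinearMap.inCoordinates, ofCoords]
  rfl

end Chart

/-! ### The dynamical system, its trajectories and the deviation function in coordinates. -/

section LocalField

variable {n : ℕ} {M : Type*} [TopologicalSpace M] [ChartedSpace (Coord n) M]
  [IsManifold (baseModel n) ∞ M] {φ : OpenPartialHomeomorph M (Coord n)}
  {X : CotangentField n M}

theorem isOpen_chartDomain (φ : OpenPartialHomeomorph M (Coord n)) :
    IsOpen {q : CotangentBundle n M | q.proj ∈ φ.source} :=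
  φ.open_source.preimage (FiberBundle.continuous_proj _ _)

theorem isOpen_coordDomain (φ : OpenPartialHomeomorph M (Coord n)) :
    IsOpen {z : Coord n × Coord n | z.1 ∈ φ.target} :=
  φ.open_target.preimage continuous_fst

theorem proj_ofCoords_mem {z : Coord n × Coord n} (hz : z.1 ∈ φ.target) :
    (ofCoords φ z : CotangentBundle n M).proj ∈ φ.source := φ.map_target hz

theorem coords_fst_mem {q : CotangentBundle n M} (hq : q.proj ∈ φ.source) :
    (coords φ q).1 ∈ φ.target := φ.map_source hq

theorem contDiffAt_localField (hφ : φ ∈ IsManifold.maximalAtlas (baseModel n) ∞ M)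
    (hX : IsSmoothField X) {z : Coord n × Coord n} (hz : z.1 ∈ φ.target) :
    ContDiffAt ℝ ∞ (localField φ X) z := by
  let S : Set (CotangentBundle n M) := {q | q.proj ∈ φ.source}
  have hS : IsOpen S := isOpen_chartDomain φ
  have h1 : ContMDiffOn (cotangentModel n) 𝓘(ℝ, Coord n × Coord n) ∞ (coords φ) S :=
    fun q hq => (contMDiffAt_coords hφ hq).contMDiffWithinAt
  have h2 := h1.contMDiffOn_tangentMapWithin (m := ∞) (by simp) hS.uniqueMDiffOn
  have hz' : ofCoords φ z ∈ S := proj_ofCoords_mem hz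
  have h3 := h2.contMDiffAt (x := (⟨ofCoords φ z, X (ofCoords φ z)⟩ :
      TangentBundle (cotangentModel n) (CotangentBundle n M)))
    ((hS.preimage (FiberBundle.continuous_proj _ _)).mem_nhds hz')
  have h4 := h3.comp z ((hX (ofCoords φ z)).comp z (contMDiffAt_ofCoords hφ hz))
  rw [Bundle.contMDiffAt_totalSpace] at h4
  have h5 := h4.2
  rw [contMDiffAt_iff_contDiffAt] at h5
  refine h5.congr_of_eventuallyEq ?_
  filter_upwards [(isOpen_coordDomain φ).mem_nhds hz] with w hw
  have hw' : ofCoords φ w ∈ S := proj_ofCoords_mem hw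
  have h6 := mfderivWithin_of_isOpen (I := cotangentModel n) (I' := 𝓘(ℝ, Coord n × Coord n))
    (f := coords φ) hS hw'
  simp only [Function.comp, tangentMapWithin, localField]
  rw [h6]
  simp
  rfl

theorem localField_coords (hφ : φ ∈ IsManifold.maximalAtlas (baseModel n) ∞ M)
    (X : CotangentField n M) {q : CotangentBundle n M} (hq : q.proj ∈ φ.source) :
    localField φ X (coords φ q)
      = mfderiv (cotangentModel n) 𝓘(ℝ, Coord n × Coord n) (coords φ) q (X q) := by
  have : ∀ q', q' = q → mfderiv (cotangentModel n) 𝓘(ℝ, Coord n × Coord n) (coords φ) q' (X q')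
      = mfderiv (cotangentModel n) 𝓘(ℝ, Coord n × Coord n) (coords φ) q (X q) := by
    rintro _ rfl; rfl
  exact this _ (ofCoords_coords hφ hq)

theorem hasDerivAt_coords_comp (hφ : φ ∈ IsManifold.maximalAtlas (baseModel n) ∞ M)
    {γ : ℝ → CotangentBundle n M} {t : ℝ} (ht : (γ t).proj ∈ φ.source)
    (hγ : HasMFDerivAt 𝓘(ℝ, ℝ) (cotangentModel n) γ t ((1 : ℝ →L[ℝ] ℝ).smulRight (X (γ t)))) :
    HasDerivAt (fun s => coords φ (γ s)) (localField φ X (coords φ (γ t))) t := by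
  have h1 := ((contMDiffAt_coords hφ ht).mdifferentiableAt (by simp)).hasMFDerivAt.comp t hγ
  have h2 : (mfderiv (cotangentModel n) 𝓘(ℝ, Coord n × Coord n) (coords φ) (γ t))
      ((1 : ℝ) • X (γ t)) = localField φ X (coords φ (γ t)) := by
    rw [localField_coords hφ X ht, one_smul]
  obtain ⟨L, hL, hL1⟩ : ∃ L : ℝ →L[ℝ] Coord n × Coord n,
      HasFDerivAt (fun s => coords φ (γ s)) L t ∧ L 1 = localField φ X (coords φ (γ t)) :=
    ⟨_, hasMFDerivAt_iff_hasFDerivAt.1 h1, h2⟩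
  exact hL1 ▸ hL.hasDerivAt

/-- Differentiating `ofCoords φ ∘ coords φ = id` shows that the differential of `ofCoords φ` carries
the local field back to `X`. -/
theorem hasMFDerivWithinAt_ofCoords_comp
    (hφ : φ ∈ IsManifold.maximalAtlas (baseModel n) ∞ M)
    {c : ℝ → Coord n × Coord n} {s : Set ℝ} {t : ℝ} (ht : (c t).1 ∈ φ.target)
    (hc : HasDerivWithinAt c (localField φ X (c t)) s t) :
    HasMFDerivWithinAt 𝓘(ℝ, ℝ) (cotangentModel n) (fun r => ofCoords φ (c r)) s t
      ((1 : ℝ →L[ℝ] ℝ).smulRight (X (ofCoords φ (c t)))) := by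
  have h0 : MDifferentiableAt 𝓘(ℝ, Coord n × Coord n) (cotangentModel n)
    (ofCoords φ : Coord n × Coord n → CotangentBundle n M) (c t) :=
    (contMDiffAt_ofCoords hφ ht).mdifferentiableAt (by simp)
  have h0m : HasMFDerivAt 𝓘(ℝ, Coord n × Coord n) (cotangentModel n)
      (ofCoords φ : Coord n × Coord n → CotangentBundle n M) (c t)
      (mfderiv 𝓘(ℝ, Coord n × Coord n) (cotangentModel n)
        (ofCoords φ : Coord n × Coord n → CotangentBundle n M) (c t)) := h0.hasMFDerivAt
  have hm := proj_ofCoords_mem (M := M) ht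
  have h0' : MDifferentiableAt (cotangentModel n) 𝓘(ℝ, Coord n × Coord n) (coords φ)
      (ofCoords φ (c t)) := (contMDiffAt_coords hφ hm).mdifferentiableAt (by simp)
  have hc' : HasMFDerivWithinAt 𝓘(ℝ, ℝ) 𝓘(ℝ, Coord n × Coord n) c s t
      (ContinuousLinearMap.toSpanSingleton ℝ (localField φ X (c t))) :=
    HasFDerivWithinAt.hasMFDerivWithinAt hc.hasFDerivWithinAt
  have h1 := HasMFDerivAt.comp_hasMFDerivWithinAt (I' := 𝓘(ℝ, Coord n × Coord n)) t h0m hc'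
  refine h1.congr_mfderiv ?_
  have h2 : HasMFDerivAt (cotangentModel n) (cotangentModel n)
      (fun q => ofCoords φ (coords φ q)) (ofCoords φ (c t))
      ((mfderiv 𝓘(ℝ, Coord n × Coord n) (cotangentModel n)
        (ofCoords φ : Coord n × Coord n → CotangentBundle n M) (c t)).comp
        (mfderiv (cotangentModel n) 𝓘(ℝ, Coord n × Coord n) (coords φ) (ofCoords φ (c t)))) := by
    refine HasMFDerivAt.comp (I' := 𝓘(ℝ, Coord n × Coord n)) (g := ofCoords φ) (f := coords φ)
      (ofCoords φ (c t)) ?_ h0'.hasMFDerivAt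
    rw [coords_ofCoords hφ ht]
    exact h0m
  have h3 : HasMFDerivAt (cotangentModel n) (cotangentModel n)
      (fun q : CotangentBundle n M => ofCoords φ (coords φ q)) (ofCoords φ (c t))
      (ContinuousLinearMap.id ℝ _) := by
    refine (hasMFDerivAt_id _).congr_of_eventuallyEq ?_
    filter_upwards [(isOpen_chartDomain φ).mem_nhds hm] with q hq
    exact ofCoords_coords hφ hq
  have h4 := hasMFDerivAt_unique h2 h3
  have h5 := DFunLike.congr_fun h4 (X (ofCoords φ (c t)))
  refine ContinuousLinearMap.ext_ring ?_
  change mfderiv 𝓘(ℝ, Coord n × Coord n) (cotangentModel n)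
        (ofCoords φ : Coord n × Coord n → CotangentBundle n M) (c t)
        ((1 : ℝ) • localField φ X (c t)) = (1 : ℝ) • X (ofCoords φ (c t))
  rw [one_smul, one_smul]
  exact h5

theorem localField_fst (hφ : φ ∈ IsManifold.maximalAtlas (baseModel n) ∞ M)
    (X : CotangentField n M) {z : Coord n × Coord n} (hz : z.1 ∈ φ.target) :
    (localField φ X z).1 = chartDeriv φ (φ.symm z.1) (velocity X (ofCoords φ z)) := by
  have hm := proj_ofCoords_mem (M := M) hz
  have h1 := ((contMDiffAt_coords hφ hm).mdifferentiableAt (n := ∞) (by simp)).hasMFDerivAt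
  have h2 : HasMFDerivAt (cotangentModel n) (baseModel n)
      (Bundle.TotalSpace.proj : CotangentBundle n M → M) (ofCoords φ z) _ :=
    ((Bundle.contMDiffAt_proj (n := ∞) _).mdifferentiableAt (by simp)).hasMFDerivAt
  have h3 := ((contMDiffAt_chart hφ hm).mdifferentiableAt (n := ∞) (by simp)).hasMFDerivAt.comp _ h2
  have h4 : HasMFDerivAt 𝓘(ℝ, Coord n × Coord n) 𝓘(ℝ, Coord n) Prod.fst (coords φ (ofCoords φ z))
      (ContinuousLinearMap.fst ℝ (Coord n) (Coord n)) :=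
    hasMFDerivAt_iff_hasFDerivAt.2 hasFDerivAt_fst
  have h5 := hasMFDerivAt_unique (h4.comp _ h1) h3
  exact DFunLike.congr_fun h5 (X (ofCoords φ z))

theorem ofCoords_snd_eq_zero_iff (hφ : φ ∈ IsManifold.maximalAtlas (baseModel n) ∞ M)
    {z : Coord n × Coord n} (hz : z.1 ∈ φ.target) :
    (ofCoords φ z : CotangentBundle n M).2 = 0 ↔ z.2 = 0 := by
  constructor
  · intro h
    have h1 := coords_ofCoords hφ hz
    have h2 : (coords φ (ofCoords φ z)).2 = 0 := by
      funext i
      change (ofCoords φ z : CotangentBundle n M).2 _ = 0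
      rw [h]; rfl
    rwa [h1] at h2
  · intro h
    simp only [ofCoords, h, Pi.zero_apply, zero_smul, Finset.sum_const_zero]
    rfl

theorem coords_snd_eq_zero_iff (hφ : φ ∈ IsManifold.maximalAtlas (baseModel n) ∞ M)
    {q : CotangentBundle n M} (hq : q.proj ∈ φ.source) : (coords φ q).2 = 0 ↔ q.2 = 0 := by
  rw [← ofCoords_snd_eq_zero_iff hφ (coords_fst_mem hq)]
  have : ∀ q', q' = q → (q'.2 = 0 ↔ q.2 = 0) := by rintro _ rfl; rfl
  exact this _ (ofCoords_coords hφ hq)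

theorem deviation_eq_pairing (hφ : φ ∈ IsManifold.maximalAtlas (baseModel n) ∞ M)
    {F : ℝ × ℝ → CotangentBundle n M} {t : ℝ}
    (hF : ContMDiffAt 𝓘(ℝ, ℝ × ℝ) (cotangentModel n) ∞ F (t, 0))
    (ht : (F (t, 0)).proj ∈ φ.source) :
    deviation F t = pairing (coords φ (F (t, 0)))
      (fderiv ℝ (fun q => coords φ (F q)) (t, 0) (0, 1)) := by
  rw [deviation, apply_eq_sum_coords hφ ht, pairing]
  refine Finset.sum_congr rfl fun i _ => ?_
  congr 1
  have hline : HasMFDerivAt 𝓘(ℝ, ℝ) 𝓘(ℝ, ℝ × ℝ) (fun y : ℝ => (t, y)) 0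
      (ContinuousLinearMap.inr ℝ ℝ ℝ) :=
    hasMFDerivAt_iff_hasFDerivAt.2 (hasFDerivAt_prodMk_right t 0)
  have hproj : MDifferentiableAt 𝓘(ℝ, ℝ) (baseModel n) (fun y : ℝ => (F (t, y)).proj) 0 :=
    MDifferentiableAt.comp (0 : ℝ) ((Bundle.contMDiffAt_proj (n := ∞) _).mdifferentiableAt (by simp))
      (MDifferentiableAt.comp (0 : ℝ) (hF.mdifferentiableAt (by simp)) hline.mdifferentiableAt)
  have h1 := HasMFDerivAt.comp (0 : ℝ) (g := φ) (f := fun y : ℝ => (F (t, y)).proj)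
    ((contMDiffAt_chart hφ ht).mdifferentiableAt (n := ∞) (by simp)).hasMFDerivAt
    hproj.hasMFDerivAt
  have h2 : DifferentiableAt ℝ (fun q => coords φ (F q)) (t, 0) :=
    (contMDiffAt_iff_contDiffAt.1 ((contMDiffAt_coords hφ ht).comp (t, (0 : ℝ)) hF)).differentiableAt
      (by simp)
  have h3 : HasFDerivAt (fun y : ℝ => (coords φ (F (t, y))).1)
      ((ContinuousLinearMap.fst ℝ (Coord n) (Coord n)).comp
        ((fderiv ℝ (fun q => coords φ (F q)) (t, 0)).comp (ContinuousLinearMap.inr ℝ ℝ ℝ))) 0 :=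
    hasFDerivAt_fst.comp (0 : ℝ) (h2.hasFDerivAt.comp (0 : ℝ) (hasFDerivAt_prodMk_right t 0))
  have h4 := hasMFDerivAt_unique h1 (hasMFDerivAt_iff_hasFDerivAt.2 h3)
  exact congrFun (DFunLike.congr_fun h4 1) i

end LocalField

/-- Bootstrapping: `c' = G ∘ c` is as smooth as `c`, so each step gains one derivative. -/
theorem contDiffOn_of_hasDerivAt {W : Type*} [NormedAddCommGroup W] [NormedSpace ℝ W] {G : W → W}
    {c : ℝ → W} {s : Set ℝ} (hs : IsOpen s) (hG : ∀ t ∈ s, ContDiffAt ℝ ∞ G (c t))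
    (hc : ∀ t ∈ s, HasDerivAt c (G (c t)) t) : ContDiffOn ℝ ∞ c s := by
  refine contDiffOn_infty.2 fun k => ?_
  induction k with
  | zero => exact contDiffOn_zero.2 fun t ht => (hc t ht).continuousAt.continuousWithinAt
  | succ k ih =>
    rw [Nat.cast_succ, contDiffOn_succ_iff_deriv_of_isOpen hs]
    refine ⟨fun t ht => (hc t ht).differentiableAt.differentiableWithinAt, by simp, ?_⟩
    refine ContDiffOn.congr (f := fun t => G (c t)) (fun t ht => ?_) fun t ht => (hc t ht).deriv
    exact ((hG t ht).of_le (by exact_mod_cast le_top)).comp_contDiffWithinAt t (ih t ht)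

/-! ### Deviation functions of trajectory families, and consequences of regularity. -/

section Families

variable {n : ℕ} {M : Type*} [TopologicalSpace M] [ChartedSpace (Coord n) M]
  [IsManifold (baseModel n) ∞ M] {φ : OpenPartialHomeomorph M (Coord n)}
  {X : CotangentField n M}

/-- In the coordinates of a chart, the deviation function of a family of trajectories and its
first two derivatives depend on the point and on the variation vector only. -/
theorem exists_variation (hφ : φ ∈ IsManifold.maximalAtlas (baseModel n) ∞ M)
    (hX : IsSmoothField X) {γ : ℝ → CotangentBundle n M} {J : Set ℝ}
    {F : ℝ × ℝ → CotangentBundle n M} {U : Set (ℝ × ℝ)} (hF : IsTrajectoryFamily X γ J F U)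
    {t : ℝ} (ht : (t, (0 : ℝ)) ∈ U) (htφ : (F (t, 0)).proj ∈ φ.source) :
    deviation F t = pairing (coords φ (F (t, 0)))
        (fderiv ℝ (fun q => coords φ (F q)) (t, 0) (0, 1)) ∧
      deriv (deviation F) t = devRate (localField φ X) (coords φ (F (t, 0)))
        (fderiv ℝ (fun q => coords φ (F q)) (t, 0) (0, 1)) ∧
      deriv (deriv (deviation F)) t = devAccel (localField φ X) (coords φ (F (t, 0)))
        (fderiv ℝ (fun q => coords φ (F q)) (t, 0) (0, 1)) := by
  set f : ℝ × ℝ → Coord n × Coord n := fun q => coords φ (F q) with hf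
  set v : ℝ → Coord n × Coord n := fun s => fderiv ℝ f (s, 0) (0, 1) with hv
  have hopen : IsOpen (U ∩ F ⁻¹' {q : CotangentBundle n M | q.proj ∈ φ.source}) :=
    hF.smooth.continuousOn.isOpen_inter_preimage hF.isOpen (isOpen_chartDomain φ)
  set N := U ∩ F ⁻¹' {q : CotangentBundle n M | q.proj ∈ φ.source}
  have hFat : ∀ r ∈ N, ContMDiffAt 𝓘(ℝ, ℝ × ℝ) (cotangentModel n) ∞ F r := fun r hr =>
    hF.smooth.contMDiffAt (hF.isOpen.mem_nhds hr.1)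
  have hfs : ∀ r ∈ N, ContDiffAt ℝ ∞ f r := fun r hr =>
    contMDiffAt_iff_contDiffAt.1 ((contMDiffAt_coords hφ hr.2).comp r (hFat r hr))
  have hG : ∀ r ∈ N, ContDiffAt ℝ ∞ (localField φ X) (f r) := fun r hr =>
    contDiffAt_localField hφ hX (coords_fst_mem hr.2)
  have hsol : ∀ r ∈ N, HasDerivAt (fun s => f (s, r.2)) (localField φ X (f r)) r.1 := by
    rintro ⟨s, y⟩ hr
    have h1 : IsOpen {t | (t, y) ∈ U} := hF.isOpen.preimage (by fun_prop)
    exact hasDerivAt_coords_comp (γ := fun t => F (t, y)) hφ hr.2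
      ((hF.trajectory y s hr.1).hasMFDerivAt (h1.mem_nhds hr.1))
  have hopen0 : IsOpen {s : ℝ | (s, (0 : ℝ)) ∈ N} := hopen.preimage (by fun_prop)
  have hvar : ∀ s, (s, (0 : ℝ)) ∈ N →
      HasDerivAt v (fderiv ℝ (localField φ X) (f (s, 0)) (v s)) s := fun s hs =>
    hasDerivAt_variation (q := (s, 0)) (hfs _ hs) ((hG _ hs).differentiableAt (by simp))
      (Filter.mem_of_superset (hopen.mem_nhds hs) hsol)
  have h0 : ∀ s, (s, (0 : ℝ)) ∈ N → deviation F s = pairing (f (s, 0)) (v s) := fun s hs =>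
    deviation_eq_pairing hφ (hFat _ hs) hs.2
  have h1 : ∀ s, (s, (0 : ℝ)) ∈ N →
      deriv (deviation F) s = devRate (localField φ X) (f (s, 0)) (v s) := fun s hs => by
    refine ((hasDerivAt_pairing (z := fun s => f (s, 0)) (hsol _ hs) (hvar s hs)
      rfl).congr_of_eventuallyEq ?_).deriv
    exact Filter.mem_of_superset (hopen0.mem_nhds hs) h0
  have h2 : ∀ s, (s, (0 : ℝ)) ∈ N →
      deriv (deriv (deviation F)) s = devAccel (localField φ X) (f (s, 0)) (v s) := fun s hs => by
    refine ((hasDerivAt_devRate (z := fun s => f (s, 0)) (hG _ hs) (hsol _ hs)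
      (hvar s hs)).congr_of_eventuallyEq ?_).deriv
    exact Filter.mem_of_superset (hopen0.mem_nhds hs) h1
  exact ⟨h0 t ⟨ht, htφ⟩, h1 t ⟨ht, htφ⟩, h2 t ⟨ht, htφ⟩⟩

theorem contMDiffAt_tangent_fibre (hφ : φ ∈ IsManifold.maximalAtlas (baseModel n) ∞ M)
    {x : Coord n} (hx : x ∈ φ.target) (w : Coord n) :
    ContMDiffAt 𝓘(ℝ, Coord n) (baseModel n).tangent ∞
      (fun w : Coord n => (⟨φ.symm x, (chartDeriv φ (φ.symm x)).inverse w⟩ :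
        TangentBundle (baseModel n) M)) w := by
  have h3 : ContMDiffAt (baseModel n).tangent (baseModel n).tangent ∞
      (tangentMapWithin (baseModel n) (baseModel n) φ.symm φ.target)
        (⟨x, w⟩ : TangentBundle (baseModel n) (Coord n)) := by
    have h4 := (contMDiffOn_symm_of_mem_maximalAtlas hφ).contMDiffOn_tangentMapWithin
      (m := ∞) (by simp) φ.open_target.uniqueMDiffOn
    refine h4.contMDiffAt ?_
    exact (φ.open_target.preimage (FiberBundle.continuous_proj _ _)).mem_nhds hx
  have h5 : ContMDiffAt 𝓘(ℝ, Coord n) (baseModel n).tangent ∞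
    (fun w : Coord n => (⟨x, w⟩ : TangentBundle (baseModel n) (Coord n))) w := by
    rw [Bundle.contMDiffAt_totalSpace]
    refine ⟨contMDiffAt_const, ?_⟩
    simpa using! contDiffAt_id.contMDiffAt
  refine (h3.comp w h5).congr_of_eventuallyEq (Filter.Eventually.of_forall fun u => ?_)
  refine Bundle.TotalSpace.ext rfl (heq_of_eq ?_)
  change (chartDeriv φ (φ.symm x)).inverse u
    = mfderivWithin (baseModel n) (baseModel n) φ.symm φ.target x u
  rw [inverse_chartDeriv_eq_mfderiv hφ (φ.map_target hx), φ.right_inv hx,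
    mfderivWithin_of_isOpen φ.open_target hx]
  rfl

/-- The velocity of a field with a regular Legendre map is a submersion in the fibre direction. -/
theorem exists_fderiv_localField_fst_eq (hφ : φ ∈ IsManifold.maximalAtlas (baseModel n) ∞ M)
    (hX : IsSmoothField X) {lam : TangentBundle (baseModel n) M → CotangentBundle n M}
    (hreg : IsRegularLegendre lam X) {x p : Coord n} (hx : x ∈ φ.target) (w : Coord n) :
    ∃ u : Coord n, (fderiv ℝ (localField φ X) (x, p) (0, u)).1 = w := by
  -- The map `λ` on one fibre, in coordinates. It is a smooth left inverse of `p ↦ V(x, p)`, so the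
  -- fibre derivative of `V` is injective, hence surjective in finite dimension.
  set g : Coord n → Coord n × Coord n := fun w =>
    coords φ (lam ⟨φ.symm x, (chartDeriv φ (φ.symm x)).inverse w⟩) with hg
  have hm := φ.map_target hx
  have hgs : ∀ w, DifferentiableAt ℝ g w := fun w => by
    have h1 := (hreg.smooth ⟨φ.symm x, (chartDeriv φ (φ.symm x)).inverse w⟩).comp w
      (contMDiffAt_tangent_fibre hφ hx w)
    have h2 : (lam ⟨φ.symm x, (chartDeriv φ (φ.symm x)).inverse w⟩).proj ∈ φ.source := by
      rw [hreg.fibre]; exact hm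
    exact (contMDiffAt_iff_contDiffAt.1 ((contMDiffAt_coords hφ h2).comp w h1)).differentiableAt
      (by simp)
  have hinv : ∀ p, g (localField φ X (x, p)).1 = (x, p) := fun p => by
    have h1 : (chartDeriv φ (φ.symm x)).inverse (localField φ X (x, p)).1
        = velocity X (ofCoords φ (x, p)) := by
      rw [localField_fst hφ X (z := (x, p)) hx, inverse_chartDeriv hφ hm, ← coe_chartEquiv hφ hm]
      exact (chartEquiv hφ hm).symm_apply_apply _
    have h2 : g (localField φ X (x, p)).1 = coords φ (lam (velocityMap X (ofCoords φ (x, p)))) := by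
      rw [hg]
      change coords φ (lam ⟨φ.symm x, _⟩) = coords φ (lam ⟨φ.symm x, _⟩)
      rw [h1]
    rw [h2, hreg.right_inv, coords_ofCoords hφ (z := (x, p)) hx]
  have hd : HasFDerivAt (localField φ X) (fderiv ℝ (localField φ X) (x, p)) (x, p) :=
    ((contDiffAt_localField hφ hX (z := (x, p)) hx).differentiableAt (by simp)).hasFDerivAt
  have h1 := hasFDerivAt_fst.comp p (hd.comp p (hasFDerivAt_prodMk_right x p))
  have h2 := (hgs (localField φ X (x, p)).1).hasFDerivAt.comp p h1
  have h3 : HasFDerivAt (fun p => (x, p)) _ p := h2.congr_of_eventuallyEq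
    (Filter.Eventually.of_forall fun p => (hinv p).symm)
  have h4 := h3.unique (hasFDerivAt_prodMk_right x p)
  set D := (ContinuousLinearMap.fst ℝ (Coord n) (Coord n)).comp
    ((fderiv ℝ (localField φ X) (x, p)).comp (ContinuousLinearMap.inr ℝ (Coord n) (Coord n)))
  have hinj : Function.Injective (D : Coord n →ₗ[ℝ] Coord n) := by
    refine (injective_iff_map_eq_zero _).2 fun u hu => ?_
    have h5 := DFunLike.congr_fun h4 u
    change fderiv ℝ g _ (D u) = (0, u) at h5
    rw [show D u = 0 from hu, map_zero] at h5
    exact (congrArg Prod.snd h5).symm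
  obtain ⟨u, hu⟩ := LinearMap.injective_iff_surjective.1 hinj w
  exact ⟨u, hu⟩

theorem localField_fst_eq_zero (hφ : φ ∈ IsManifold.maximalAtlas (baseModel n) ∞ M)
    {lam : TangentBundle (baseModel n) M → CotangentBundle n M}
    (hreg : IsRegularLegendre lam X) {x : Coord n} (hx : x ∈ φ.target) :
    (localField φ X (x, 0)).1 = 0 := by
  have h : velocity X (ofCoords φ (x, 0)) = 0 :=
    (hreg.velocity_eq_zero _).2 ((ofCoords_snd_eq_zero_iff hφ (z := (x, 0)) hx).2 rfl)
  rw [localField_fst hφ X (z := (x, 0)) hx, h]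
  exact map_zero (chartDeriv φ (φ.symm x))

/-- Regularity supplies `Ω ≠ 0`, so the pointwise criterion applies. The connection has disappeared
from the right side. -/
theorem weakNormalityEquations_iff (Γ : SymmExtConnection n M) (hX : IsSmoothField X)
    {lam : TangentBundle (baseModel n) M → CotangentBundle n M} (hreg : IsRegularLegendre lam X) :
    WeakNormalityEquations Γ X ↔ ∀ φ ∈ IsManifold.maximalAtlas (baseModel n) ∞ M,
      ∀ z : Coord n × Coord n, z.1 ∈ φ.target → z.2 ≠ 0 → ∃ A B : ℝ, ∀ v,
        devAccel (localField φ X) z v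
          = A * devRate (localField φ X) z v + B * pairing z v := by
  refine forall₂_congr fun φ hφ => forall₃_congr fun z hz hp => ?_
  have hnhds := (isOpen_coordDomain φ).mem_nhds hz
  refine (exists_linear_relation_iff (Γ := Γ.comp φ) (contDiffAt_localField hφ hX hz)
    (fun k i j => ((Γ.smooth φ hφ k i j) z ⟨hz, trivial⟩).contDiffAt ?_) ?_
    (hreg.Omega_ne_zero φ hφ z hz hp)).symm
  · exact Filter.mem_of_superset hnhds fun w hw => ⟨hw, trivial⟩
  · exact Filter.mem_of_superset hnhds fun w hw k i j => Γ.symm φ hφ k i j w hw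

end Families

/-- The test variation `(0, p)` has zero pairing and rate `Ω`; this lets the coefficient `A` be
solved for. The zero connection suffices for the computation. -/
theorem devRate_vertical_self {n : ℕ} {G : Coord n × Coord n → Coord n × Coord n}
    {z : Coord n × Coord n} (hG : DifferentiableAt ℝ G z) :
    devRate G z (0, z.2) = Omega (fun i w => (G w).1 i) z := by
  rw [devRate_eq (Γ := fun _ _ _ _ => 0) (fun _ _ _ => rfl) hG]
  simp [vertPart, Omega, mul_comm]

/-- Smooth functions on an open set of reals with values in convex sets can be patched together. -/
theorem exists_contDiffOn_forall_mem_convex_of_local {F : Type*} [NormedAddCommGroup F]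
    [NormedSpace ℝ F] {J : Set ℝ} (hJ : IsOpen J) {C : ℝ → Set F} (hC : ∀ t, Convex ℝ (C t))
    (hloc : ∀ t ∈ J, ∃ N ∈ 𝓝 t, ∃ g : ℝ → F, ContDiffOn ℝ ∞ g N ∧ ∀ s ∈ N, g s ∈ C s) :
    ∃ g : ℝ → F, ContDiffOn ℝ ∞ g J ∧ ∀ t ∈ J, g t ∈ C t := by
  classical
  -- The partition of unity argument is global on a manifold, so `J` itself is taken as the
  -- manifold.
  let O : TopologicalSpace.Opens ℝ := ⟨J, hJ⟩
  have : LocallyCompactSpace O := hJ.locallyCompactSpace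
  obtain ⟨g, hg⟩ := exists_contMDiffMap_forall_mem_convex_of_local (n := ⊤) (M := O) 𝓘(ℝ, ℝ)
    (t := fun t : O => C t) (fun t => hC t) (by
      intro t
      obtain ⟨N, hN, g, hg, hgC⟩ := hloc t t.2
      refine ⟨Subtype.val ⁻¹' N, continuous_subtype_val.continuousAt.preimage_mem_nhds hN,
        fun s => g s, ?_, fun s hs => hgC s hs⟩
      exact hg.contMDiffOn.comp contMDiff_subtype_val.contMDiffOn fun s hs => hs)
  let f : ℝ → F := fun t => if h : t ∈ J then g ⟨t, h⟩ else 0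
  have hf : (fun s : O => f s) = g := by
    funext s
    exact dif_pos s.2
  refine ⟨f, fun t ht => ContDiffAt.contDiffWithinAt ?_, fun t ht => ?_⟩
  · rw [← contMDiffAt_iff_contDiffAt]
    have h1 : ContMDiffAt 𝓘(ℝ, ℝ) 𝓘(ℝ, F) ∞ (fun s : O => f s) ⟨t, ht⟩ := by
      rw [hf]; exact g.contMDiff.contMDiffAt
    exact contMDiffAt_subtype_iff.1 h1
  · have h2 := congrFun hf ⟨t, ht⟩
    change f t = _ at h2
    rw [h2]
    exact hg ⟨t, ht⟩

/-! ### Weak normality and the pointwise linear relation. -/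

section Normality

variable {n : ℕ} {M : Type*} [TopologicalSpace M] [ChartedSpace (Coord n) M]
  [IsManifold (baseModel n) ∞ M] {X : CotangentField n M}

/-- Let the initial point run along `z + y v`: the flow gives a family with variation `v` at `t =
0`. All these families contain the one trajectory through `z`, so the same `A 0` and `B 0` serve
every `v`. -/
theorem exists_linear_relation_of_weakNormality (hX : IsSmoothField X) (h : WeakNormality X)
    {φ : OpenPartialHomeomorph M (Coord n)}
    (hφ : φ ∈ IsManifold.maximalAtlas (baseModel n) ∞ M) {z : Coord n × Coord n}
    (hz : z.1 ∈ φ.target) :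
    ∃ A B : ℝ, ∀ v, devAccel (localField φ X) z v
      = A * devRate (localField φ X) z v + B * pairing z v := by
  obtain ⟨ε, D, Φ, hε, hD, hzD, hΦ, hΦ0, hsol⟩ := exists_smooth_localFlow (isOpen_coordDomain φ)
    (fun w hw => (contDiffAt_localField hφ hX hw).contDiffWithinAt) hz
  have hmem0 : (0 : ℝ) ∈ Set.Ioo (-ε) ε := ⟨by linarith, hε⟩
  have hcurve : ∀ w ∈ D, ∀ t ∈ Set.Ioo (-ε) ε, ∀ s,
      HasMFDerivWithinAt 𝓘(ℝ, ℝ) (cotangentModel n) (fun r => ofCoords φ (Φ (r, w))) s t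
        ((1 : ℝ →L[ℝ] ℝ).smulRight (X (ofCoords φ (Φ (t, w))))) := fun w hw t ht s =>
    hasMFDerivWithinAt_ofCoords_comp (c := fun r => Φ (r, w)) hφ (hsol t ht w hw).1
      (hsol t ht w hw).2.hasDerivWithinAt
  obtain ⟨A, B, -, -, hAB⟩ := h (Set.Ioo (-ε) ε) (fun t => ofCoords φ (Φ (t, z))) isOpen_Ioo
    Set.ordConnected_Ioo fun t ht => hcurve z hzD t ht _
  refine ⟨A 0, B 0, fun v => ?_⟩
  set U : Set (ℝ × ℝ) := {r | r.1 ∈ Set.Ioo (-ε) ε ∧ z + r.2 • v ∈ D} with hU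
  set F : ℝ × ℝ → CotangentBundle n M := fun r => ofCoords φ (Φ (r.1, z + r.2 • v)) with hF
  have hUo : IsOpen U := (isOpen_Ioo.preimage continuous_fst).inter
    (hD.preimage (by fun_prop))
  have hΦU : ∀ r ∈ U, ContDiffAt ℝ ∞ (fun r : ℝ × ℝ => Φ (r.1, z + r.2 • v)) r := fun r hr =>
    ContDiffAt.comp (f := fun r : ℝ × ℝ => (r.1, z + r.2 • v)) r
      (hΦ.contDiffAt ((isOpen_Ioo.prod hD).mem_nhds ⟨hr.1, hr.2⟩)) (by fun_prop)
  have hfam : IsTrajectoryFamily X (fun t => ofCoords φ (Φ (t, z))) (Set.Ioo (-ε) ε) F U := by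
    refine ⟨hUo, fun t ht => ⟨ht, by simpa using hzD⟩, fun r hr => ?_, fun y t ht => ?_,
      fun t ht => by simp [hF]⟩
    · exact ((contMDiffAt_ofCoords hφ (hsol r.1 hr.1 _ hr.2).1).comp r
        (hΦU r hr).contMDiffAt).contMDiffWithinAt
    · exact hcurve _ ht.2 t ht.1 _
  have h0U : ((0 : ℝ), (0 : ℝ)) ∈ U := hfam.mem 0 hmem0
  have hF0 : coords φ (F (0, 0)) = z := by
    have : F (0, 0) = ofCoords φ z := by simp [hF, hΦ0 z hzD]
    rw [this, coords_ofCoords hφ hz]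
  have hvar : fderiv ℝ (fun q => coords φ (F q)) (0, 0) (0, 1) = v := by
    have h1 : (fun q => coords φ (F q)) =ᶠ[𝓝 (0, 0)] fun r => Φ (r.1, z + r.2 • v) := by
      filter_upwards [hUo.mem_nhds h0U] with r hr
      exact coords_ofCoords hφ (hsol r.1 hr.1 _ hr.2).1
    rw [h1.fderiv_eq]
    have h2 := ((hΦU _ h0U).differentiableAt (by simp)).hasFDerivAt.comp_hasDerivAt (0 : ℝ)
      ((hasDerivAt_const (0 : ℝ) (0 : ℝ)).prodMk (hasDerivAt_id (0 : ℝ)))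
    have h3 : HasDerivAt (fun y : ℝ => z + y • v) v 0 := by
      simpa using ((hasDerivAt_id (0 : ℝ)).smul_const v).const_add z
    refine h2.unique (h3.congr_of_eventuallyEq ?_)
    have h4 : ∀ᶠ y : ℝ in 𝓝 0, z + y • v ∈ D :=
      (hD.preimage (f := fun y : ℝ => z + y • v) (by fun_prop)).mem_nhds (by simpa using hzD)
    filter_upwards [h4] with y hy
    exact hΦ0 _ hy
  have hmem : (F (0, 0)).proj ∈ φ.source := by
    exact proj_ofCoords_mem (hsol 0 hmem0 _ h0U.2).1
  obtain ⟨h0, h1, h2⟩ := exists_variation hφ hX hfam h0U hmem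
  have h3 := hAB F U hfam 0 hmem0
  rwa [h0, h1, h2, hF0, hvar] at h3

theorem localField_zero_section (hn : 2 ≤ n) (hX : IsSmoothField X)
    {lam : TangentBundle (baseModel n) M → CotangentBundle n M} (hreg : IsRegularLegendre lam X)
    {φ : OpenPartialHomeomorph M (Coord n)} (hφ : φ ∈ IsManifold.maximalAtlas (baseModel n) ∞ M)
    (h : ∀ z : Coord n × Coord n, z.1 ∈ φ.target → z.2 ≠ 0 → ∃ A B : ℝ, ∀ v,
      devAccel (localField φ X) z v = A * devRate (localField φ X) z v + B * pairing z v)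
    {x : Coord n} (hx : x ∈ φ.target) : localField φ X (x, 0) = 0 := by
  refine Prod.ext (localField_fst_eq_zero hφ hreg hx) ?_
  refine snd_eq_zero_of_proportional hn (contDiffAt_localField hφ hX (z := (x, 0)) hx)
    (fun w => exists_fderiv_localField_fst_eq hφ hX hreg hx w) fun p hp => ?_
  obtain ⟨A, B, hAB⟩ := h (x, p) hx hp
  exact ⟨A, fun u => by simpa [pairing] using hAB (0, u)⟩

/-- A trajectory of a field that vanishes on the zero section of `T*M` lies in the zero section if
it meets it. -/
theorem snd_eq_zero_of_isMIntegralCurveOn (hX : IsSmoothField X)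
    (h0 : ∀ φ ∈ IsManifold.maximalAtlas (baseModel n) ∞ M, ∀ x ∈ φ.target,
      localField φ X (x, 0) = 0)
    {J : Set ℝ} (hJ : IsOpen J) (hJc : J.OrdConnected) {γ : ℝ → CotangentBundle n M}
    (hγ : IsMIntegralCurveOn γ X J) {t₀ : ℝ} (ht₀ : t₀ ∈ J) (hp : (γ t₀).2 = 0) {t : ℝ}
    (ht : t ∈ J) : (γ t).2 = 0 := by
  have key : ∀ s ∈ J, ∃ φ ∈ IsManifold.maximalAtlas (baseModel n) ∞ M,
      (γ s).proj ∈ φ.source ∧ ∀ᶠ r in 𝓝 s, r ∈ J ∧ (γ r).proj ∈ φ.source ∧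
        HasDerivAt (fun t => coords φ (γ t)) (localField φ X (coords φ (γ r))) r := by
    intro s hs
    have hmem : (γ s).proj ∈ (chartAt (Coord n) (γ s).proj).source := mem_chart_source _ _
    have hφ := IsManifold.chart_mem_maximalAtlas (I := baseModel n) (n := ∞) (γ s).proj
    refine ⟨_, hφ, hmem, ?_⟩
    have hc : ContinuousAt γ s := ((hγ s hs).hasMFDerivAt (hJ.mem_nhds hs)).continuousAt
    filter_upwards [hJ.mem_nhds hs,
      hc.preimage_mem_nhds ((isOpen_chartDomain _).mem_nhds hmem)] with r hr hr'
    exact ⟨hr, hr', hasDerivAt_coords_comp hφ hr' ((hγ r hr).hasMFDerivAt (hJ.mem_nhds hr))⟩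
  -- A constant curve in the zero section is a trajectory, so local uniqueness keeps `γ` there near
  -- `s`. Relative closedness comes from continuity, and connectedness of `J` finishes.
  have hopen : IsOpen {s | s ∈ J ∧ (γ s).2 = 0} := by
    refine isOpen_iff_mem_nhds.2 ?_
    rintro s ⟨hs, hps⟩
    obtain ⟨φ, hφ, hmem, hev⟩ := key s hs
    have hx := coords_fst_mem hmem
    have hz2 : (coords φ (γ s)).2 = 0 := (coords_snd_eq_zero_iff hφ hmem).2 hps
    have hz0 : localField φ X (coords φ (γ s)) = 0 := by
      rw [show coords φ (γ s) = ((coords φ (γ s)).1, 0) from Prod.ext rfl hz2]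
      exact h0 φ hφ _ hx
    obtain ⟨K, N, hN, hK⟩ :=
      ((contDiffAt_localField hφ hX hx).of_le (by simp)).exists_lipschitzOnWith
    have hcont : ContinuousAt (fun t => coords φ (γ t)) s :=
      hev.self_of_nhds.2.2.continuousAt
    have heq : (fun t => coords φ (γ t)) =ᶠ[𝓝 s] fun _ => coords φ (γ s) := by
      refine ODE_solution_unique_of_eventually (v := fun _ => localField φ X) (s := fun _ => N)
        (Filter.Eventually.of_forall fun _ => hK) ?_ ?_ rfl
      · filter_upwards [hev, hcont.preimage_mem_nhds hN] with r hr hrN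
        exact ⟨hr.2.2, hrN⟩
      · refine Filter.Eventually.of_forall fun r => ⟨?_, mem_of_mem_nhds hN⟩
        rw [hz0]
        exact hasDerivAt_const _ _
    filter_upwards [hev, heq] with r hr hr'
    refine ⟨hr.1, (coords_snd_eq_zero_iff hφ hr.2.1).1 ?_⟩
    rw [hr', hz2]
  refine (hJc.isPreconnected.subset_of_closure_inter_subset hopen ⟨t₀, ht₀, ht₀, hp⟩ ?_ ht).2
  rintro s ⟨hcl, hs⟩
  refine ⟨hs, ?_⟩
  obtain ⟨φ, hφ, hmem, hev⟩ := key s hs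
  rw [← coords_snd_eq_zero_iff hφ hmem]
  by_contra hne
  have hcont : ContinuousAt (fun t => (coords φ (γ t)).2) s :=
    continuous_snd.continuousAt.comp hev.self_of_nhds.2.2.continuousAt
  obtain ⟨r, hr, hr', hr''⟩ :=
    ((mem_closure_iff_frequently.1 hcl).and_eventually (hev.and (hcont.eventually_ne hne))).exists
  exact hr'' ((coords_snd_eq_zero_iff hφ hr'.2.1).2 hr.2)

theorem weakNormality_of_exists_linear_relation (hn : 2 ≤ n) (hX : IsSmoothField X)
    {lam : TangentBundle (baseModel n) M → CotangentBundle n M} (hreg : IsRegularLegendre lam X)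
    (h : ∀ φ ∈ IsManifold.maximalAtlas (baseModel n) ∞ M, ∀ z : Coord n × Coord n,
      z.1 ∈ φ.target → z.2 ≠ 0 → ∃ A B : ℝ, ∀ v, devAccel (localField φ X) z v
        = A * devRate (localField φ X) z v + B * pairing z v) : WeakNormality X := by
  intro J γ hJ hJc hγ
  by_cases hzero : ∃ t ∈ J, (γ t).2 = 0
  · obtain ⟨t₀, ht₀, hp⟩ := hzero
    have hall : ∀ t ∈ J, (γ t).2 = 0 := fun t ht => snd_eq_zero_of_isMIntegralCurveOn hX
      (fun φ hφ x hx => localField_zero_section hn hX hreg hφ (h φ hφ) hx) hJ hJc hγ ht₀ hp ht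
    -- The covector vanishes along the whole trajectory, so every deviation function is zero on `J`
    -- and any coefficients would do.
    refine ⟨0, 0, contDiffOn_const, contDiffOn_const, fun F U hF => ?_⟩
    have h0 : ∀ t ∈ J, deviation F t = 0 := fun t ht => by
      have h1 : (F (t, 0)).2 = 0 := by rw [hF.eq_zero t ht]; exact hall t ht
      rw [deviation, h1]; rfl
    have h1 : ∀ t ∈ J, deriv (deviation F) t = 0 := fun t ht => by
      rw [Filter.EventuallyEq.deriv_eq (Filter.mem_of_superset (hJ.mem_nhds ht) h0 :
        deviation F =ᶠ[𝓝 t] fun _ => 0), deriv_const]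
    intro t ht
    rw [Filter.EventuallyEq.deriv_eq (Filter.mem_of_superset (hJ.mem_nhds ht) h1 :
      deriv (deviation F) =ᶠ[𝓝 t] fun _ => 0), deriv_const]
    simp
  push Not at hzero
  -- Admissible coefficient pairs at time `t`. The conditions are affine in the pair, so this set is
  -- convex, and choices made in different charts need not be compared before gluing.
  let C : ℝ → Set (ℝ × ℝ) := fun t => {c | ∀ F U, IsTrajectoryFamily X γ J F U →
    deriv (deriv (deviation F)) t = c.1 * deriv (deviation F) t + c.2 * deviation F t}
  have hC : ∀ t, Convex ℝ (C t) := by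
    intro t c hc d hd a b _ _ hab F U hF
    have h1 := hc F U hF
    have h2 := hd F U hF
    simp only [Prod.fst_add, Prod.snd_add, Prod.smul_fst, Prod.smul_snd, smul_eq_mul]
    linear_combination a * h1 + b * h2 - hab * deriv (deriv (deviation F)) t
  obtain ⟨g, hg, hgC⟩ := exists_contDiffOn_forall_mem_convex_of_local hJ hC (by
    intro t₀ ht₀
    set φ := chartAt (Coord n) (γ t₀).proj
    have hφ : φ ∈ IsManifold.maximalAtlas (baseModel n) ∞ M :=
      IsManifold.chart_mem_maximalAtlas (γ t₀).proj
    have hmem : (γ t₀).proj ∈ φ.source := mem_chart_source _ _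
    have hcont : ContinuousOn γ J := fun t ht => (hγ t ht).continuousWithinAt
    have hNo := hcont.isOpen_inter_preimage hJ (isOpen_chartDomain φ)
    set N := J ∩ γ ⁻¹' {q : CotangentBundle n M | q.proj ∈ φ.source}
    set c : ℝ → Coord n × Coord n := fun t => coords φ (γ t)
    have hG : ∀ t ∈ N, ContDiffAt ℝ ∞ (localField φ X) (c t) := fun t ht =>
      contDiffAt_localField hφ hX (coords_fst_mem ht.2)
    have hc : ContDiffOn ℝ ∞ c N := contDiffOn_of_hasDerivAt hNo hG fun t ht =>
      hasDerivAt_coords_comp hφ ht.2 ((hγ t ht.1).hasMFDerivAt (hJ.mem_nhds ht.1))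
    have hp : ∀ t ∈ N, (c t).2 ≠ 0 := fun t ht hne =>
      hzero t ht.1 ((coords_snd_eq_zero_iff hφ ht.2).1 hne)
    have hΩ : ∀ t ∈ N, devRate (localField φ X) (c t) (0, (c t).2) ≠ 0 := fun t ht => by
      rw [devRate_vertical_self ((hG t ht).differentiableAt (by simp))]
      exact hreg.Omega_ne_zero φ hφ (c t) (coords_fst_mem ht.2) (hp t ht)
    have hsq : ∀ t ∈ N, pairing (c t) ((c t).2, 0) ≠ 0 := fun t ht h0 => by
      refine hp t ht (funext fun i => ?_)
      have := (Finset.sum_eq_zero_iff_of_nonneg fun i _ => mul_self_nonneg ((c t).2 i)).1 h0 i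
        (Finset.mem_univ i)
      exact mul_self_eq_zero.1 this
    -- The variation `(0, p)` isolates `A`, with denominator `Ω`; then `(p, 0)`, whose pairing is `∑
    -- p_k²`, yields `B`. The explicit quotients make both coefficients smooth in `t`.
    let a : ℝ → ℝ := fun t => devAccel (localField φ X) (c t) (0, (c t).2)
      / devRate (localField φ X) (c t) (0, (c t).2)
    let b : ℝ → ℝ := fun t => (devAccel (localField φ X) (c t) ((c t).2, 0)
      - a t * devRate (localField φ X) (c t) ((c t).2, 0)) / pairing (c t) ((c t).2, 0)
    have hrate : ∀ t ∈ N, ∀ v : ℝ → Coord n × Coord n, ContDiffAt ℝ ∞ v t →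
        ContDiffAt ℝ ∞ (fun t => devRate (localField φ X) (c t) (v t)) t := fun t ht v hv =>
      ContDiffAt.comp (g := fun q => devRate (localField φ X) q.1 q.2) (f := fun t => (c t, v t)) t
        (contDiffAt_devRate (q := (c t, v t)) (hG t ht))
        ((hc.contDiffAt (hNo.mem_nhds ht)).prodMk hv)
    have haccel : ∀ t ∈ N, ∀ v : ℝ → Coord n × Coord n, ContDiffAt ℝ ∞ v t →
        ContDiffAt ℝ ∞ (fun t => devAccel (localField φ X) (c t) (v t)) t := fun t ht v hv =>
      ContDiffAt.comp (g := fun q => devAccel (localField φ X) q.1 q.2) (f := fun t => (c t, v t)) t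
        (contDiffAt_devAccel (q := (c t, v t)) (hG t ht))
        ((hc.contDiffAt (hNo.mem_nhds ht)).prodMk hv)
    have ha : ∀ t ∈ N, ContDiffAt ℝ ∞ a t := fun t ht => by
      have h1 : ContDiffAt ℝ ∞ c t := hc.contDiffAt (hNo.mem_nhds ht)
      exact (haccel t ht _ (by fun_prop)).div (hrate t ht _ (by fun_prop)) (hΩ t ht)
    have hb : ∀ t ∈ N, ContDiffAt ℝ ∞ b t := fun t ht => by
      have h1 : ContDiffAt ℝ ∞ c t := hc.contDiffAt (hNo.mem_nhds ht)
      have h2 : ContDiffAt ℝ ∞ (fun t => pairing (c t) ((c t).2, 0)) t := by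
        unfold pairing
        fun_prop
      exact ((haccel t ht _ (by fun_prop)).sub
        ((ha t ht).mul (hrate t ht _ (by fun_prop)))).div h2 (hsq t ht)
    refine ⟨N, hNo.mem_nhds ⟨ht₀, hmem⟩, fun t => (a t, b t),
      fun t ht => ((ha t ht).prodMk (hb t ht)).contDiffWithinAt, fun t ht F U hF => ?_⟩
    have hFt : F (t, 0) = γ t := hF.eq_zero t ht.1
    obtain ⟨h0, h1, h2⟩ := exists_variation hφ hX hF (hF.mem t ht.1) (by rw [hFt]; exact ht.2)
    obtain ⟨A, B, hAB⟩ := h φ hφ (c t) (coords_fst_mem ht.2) (hp t ht)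
    have hA : a t = A := by
      have h3 := hAB (0, (c t).2)
      rw [show pairing (c t) (0, (c t).2) = 0 by simp [pairing], mul_zero, add_zero] at h3
      exact (div_eq_iff (hΩ t ht)).2 h3
    have hB : b t = B := by
      refine (div_eq_iff (hsq t ht)).2 ?_
      rw [hA, hAB]; ring
    change _ = a t * _ + b t * _
    rw [h0, h1, h2, hFt, hA, hB]
    exact hAB _)
  exact ⟨fun t => (g t).1, fun t => (g t).2, hg.fst, hg.snd, fun F U hF t ht => hgC t ht F U hF⟩

end Normality

end NormalShift

end

theorem theorem8p1 {n : ℕ} (hn : 2 ≤ n)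
    {M : Type*} [TopologicalSpace M] [T2Space M] [ChartedSpace (NormalShift.Coord n) M]
    [IsManifold (NormalShift.baseModel n) ∞ M]
    (Γ : NormalShift.SymmExtConnection n M)
    (lam : TangentBundle (NormalShift.baseModel n) M → NormalShift.CotangentBundle n M)
    (X : NormalShift.CotangentField n M) (hX : NormalShift.IsSmoothField X)
    (hreg : NormalShift.IsRegularLegendre lam X) :
    NormalShift.WeakNormality X ↔ NormalShift.WeakNormalityEquations Γ X := by
  rw [NormalShift.weakNormalityEquations_iff Γ hX hreg]
  exact ⟨fun h φ hφ z hz _ => NormalShift.exists_linear_relation_of_weakNormality hX h hφ hz,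
    NormalShift.weakNormality_of_exists_linear_relation hn hX hreg⟩
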